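/- Let $M$ be a smooth (finite-dimensional, Hausdorff) manifold with an almost complex structure $J$ and a smooth linear connection $D$. The connection induces a decomposition $T(T^*M)=H^{D}\oplus T^{\mathrm{vert}}(T^*M)\cong\pi^*(TM\oplus T^*M)$ into horizontal and vertical subbundles, where $\pi:T^*M\to M$. Let $J^{\pm}$ be the almost complex structure on the manifold $T^*M$ which corresponds, under this identification, to the pull-back of $$\mathcal J^{\pm}=\begin{pmatrix}J&0\\0&\pm J^*\end{pmatrix}\in\mathrm{End}(TM\oplus T^*M),\qquad J^*\xi=\xi\circ J .$$ An almost complex structure is called integrable if its Nijenhuis tensor vanishes (equivalently, its bundle of $(1,0)$-vectors is involutive). Let $R^D_{X,Y}=-D_XD_Y+D_YD_X+D_{[X,Y]}$. (i) If $(J,D)$ is a special complex structure, i.e. $J$ is integrable and $D$ is flat and torsion-free with $(D_XJ)(Y)=(D_YJ)(X)$ for all $X,Y\in TM$, then $J^+$ is integrable. (ii) If $D$ is the Levi-Civita connection of an almost Hermitian structure $(g,J)$ ($g$ a Riemannian metric with $g(J\cdot,J\cdot)=g$), then $J^+$ is integrable if and only if $(g,J)$ is Kähler (i.e. $J$ is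 integrable and $\omega=g(J\cdot,\cdot)$ is closed), and $J^-$ is integrable if and only if $J$ is integrable and $$(R^D_{X,Y}-R^D_{JX,JY})(Z)-(R^D_{JX,Y}+R^D_{X,JY})(JZ)=0\qquad\text{for all }X,Y,Z\in TM.$$ (iii) If $D$ is the Chern connection of a Hermitian structure $(g,J)$ (i.e. $g$ is a Riemannian metric with $g(J\cdot,J\cdot)=g$, $J$ is integrable, and $D$ is the connection with $Dg=0$, $DJ=0$ whose $(0,1)$-part is the Dolbeault operator of the holomorphic bundle $(TM,J)$), then both $J^+$ and $J^-$ are integrable. -/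

import Mathlib

open Bundle Manifold
open scoped ContDiff Topology

noncomputable section

namespace SpecialGeometry

/-! ## Almost complex structures -/

section AlmostComplex

variable {E : Type*} [NormedAddCommGroup E] [NormedSpace ℝ E]
  {H : Type*} [TopologicalSpace H] (I : ModelWithCorners ℝ E H)
  {M : Type*} [TopologicalSpace M] [ChartedSpace H M] [IsManifold I ∞ M]

/-- The vector field `X` is smooth at (that is, near) the point `x`. -/
def SmoothFieldAt (X : ∀ x : M, TangentSpace I x) (x : M) : Prop :=
  ContMDiffAt I I.tangent ∞ (fun y => (⟨y, X y⟩ : TangentBundle I M)) x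

/-- `J` is an almost complex structure on `M`: a smooth field of endomorphisms of the tangent
bundle with `J² = -Id`. -/
structure IsAlmostComplex (J : ∀ x : M, TangentSpace I x →L[ℝ] TangentSpace I x) : Prop where
  smooth : ContMDiff I (I.prod 𝓘(ℝ, E →L[ℝ] E)) ∞
    (fun x => TotalSpace.mk' (E →L[ℝ] E)
      (E := fun x : M => TangentSpace I x →L[ℝ] TangentSpace I x) x (J x))
  sq : ∀ (x : M) (v : TangentSpace I x), J x (J x v) = -v

/-- The Nijenhuis tensor `N(X, Y) = [JX, JY] - J[JX, Y] - J[X, JY] - [X, Y]`. -/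
def nijenhuis (J : ∀ x : M, TangentSpace I x →L[ℝ] TangentSpace I x)
    (X Y : ∀ x : M, TangentSpace I x) (x : M) : TangentSpace I x :=
  VectorField.mlieBracket I (fun y => J y (X y)) (fun y => J y (Y y)) x
    - J x (VectorField.mlieBracket I (fun y => J y (X y)) Y x)
    - J x (VectorField.mlieBracket I X (fun y => J y (Y y)) x)
    - VectorField.mlieBracket I X Y x

/-- `J` is an integrable almost complex structure: its Nijenhuis tensor vanishes. Equivalently,
the bundle of `(1,0)`-vectors `X - iJX` is closed under the Lie bracket. -/
structure IsIntegrable (J : ∀ x : M, TangentSpace I x →L[ℝ] TangentSpace I x) : Prop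
    extends IsAlmostComplex I J where
  nijenhuis_eq_zero : ∀ (X Y : ∀ x : M, TangentSpace I x) (x : M),
    SmoothFieldAt I X x → SmoothFieldAt I Y x → nijenhuis I J X Y x = 0

end AlmostComplex

/-! ## The cotangent manifold and the splitting of its tangent bundle -/

section Cotangent

variable (E : Type*) [NormedAddCommGroup E] [NormedSpace ℝ E]
  (M : Type*) [TopologicalSpace M] [ChartedSpace E M] [IsManifold 𝓘(ℝ, E) ∞ M]

/-- The cotangent bundle `T*M`, with the manifold structure it has as a vector bundle. -/
abbrev Cotangent : Type _ :=
  TotalSpace (E →L[ℝ] ℝ) (fun x : M => TangentSpace 𝓘(ℝ, E) x →L[ℝ] ℝ)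

/-- The model on which the manifold `T*M` is modelled. -/
abbrev cotangentModel : ModelWithCorners ℝ (E × (E →L[ℝ] ℝ)) (ModelProd E (E →L[ℝ] ℝ)) :=
  𝓘(ℝ, E).prod 𝓘(ℝ, E →L[ℝ] ℝ)

/-- Linear connections on `M`. If `D` is one, `D Y x (X x)` is `(D_X Y)(x)`. -/
abbrev Connection : Type _ :=
  CovariantDerivative 𝓘(ℝ, E) E (fun x : M => TangentSpace 𝓘(ℝ, E) x)

variable {E M}

/-- The function `α ↦ α(Y)` on `T*M` defined by a vector field `Y` on `M`. -/
def evalField (Y : ∀ x : M, TangentSpace 𝓘(ℝ, E) x) (α : Cotangent E M) : ℝ := α.2 (Y α.1)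

/-- The differential at `γ` of the projection `π : T*M → M`. -/
def dproj (γ : Cotangent E M) :
    TangentSpace (cotangentModel E) γ →L[ℝ] TangentSpace 𝓘(ℝ, E) γ.1 :=
  mfderiv (cotangentModel E) 𝓘(ℝ, E) (TotalSpace.proj : Cotangent E M → M) γ

/-- The expression `w(α ↦ α(Y)) - γ(D_{dπ(w)} Y)`, for a tangent vector `w` of `T*M` at `γ`. -/
def verticalPartAux (D : Connection E M) (γ : Cotangent E M)
    (w : TangentSpace (cotangentModel E) γ) (Y : ∀ x : M, TangentSpace 𝓘(ℝ, E) x) : ℝ :=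
  mvfderiv (cotangentModel E) (evalField Y) γ w - γ.2 (D Y γ.1 (dproj γ w))

lemma mvfderiv_clm_comp {N F G : Type*} [NormedAddCommGroup F] [NormedSpace ℝ F]
    [NormedAddCommGroup G] [NormedSpace ℝ G] {H : Type*} [TopologicalSpace H]
    {I : ModelWithCorners ℝ E H} [TopologicalSpace N] [ChartedSpace H N]
    {c : N → F} {x : N} (hc : MDifferentiableAt I 𝓘(ℝ, F) c x) (A : F →L[ℝ] G)
    (w : TangentSpace I x) :
    mvfderiv I (A ∘ c) x w = A (mvfderiv I c x w) := by
  have := mfderiv_comp (I' := 𝓘(ℝ, F)) (I'' := 𝓘(ℝ, G)) x A.mdifferentiableAt hc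
  simp only [mvfderiv, ContinuousLinearMap.comp_apply, this, ContinuousLinearMap.mfderiv_eq]
  rfl

lemma mdifferentiableAt_evalField {Y : ∀ x : M, TangentSpace 𝓘(ℝ, E) x} {γ : Cotangent E M}
    (hY : MDifferentiableAt 𝓘(ℝ, E) 𝓘(ℝ, E).tangent
      (fun y => (⟨y, Y y⟩ : TangentBundle 𝓘(ℝ, E) M)) γ.1) :
    MDifferentiableAt (cotangentModel E) 𝓘(ℝ, ℝ) (evalField Y) γ := by
  have hπ : MDifferentiableAt (cotangentModel E) 𝓘(ℝ, E)
      (TotalSpace.proj : Cotangent E M → M) γ := mdifferentiableAt_proj _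
  have h : MDifferentiableAt (cotangentModel E) (𝓘(ℝ, E).prod 𝓘(ℝ, ℝ))
      (fun α : Cotangent E M => TotalSpace.mk' ℝ (E := Bundle.Trivial M ℝ) α.1 (α.2 (Y α.1))) γ := by
    apply MDifferentiableAt.clm_bundle_apply (F₁ := E)
      (E₁ := fun x : M => TangentSpace 𝓘(ℝ, E) x)
    · exact mdifferentiableAt_id
    · exact hY.comp γ hπ
  rw [mdifferentiableAt_totalSpace] at h
  exact h.2


lemma tensorialAt_verticalPartAux (D : Connection E M) (γ : Cotangent E M)
    (w : TangentSpace (cotangentModel E) γ) :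
    TensorialAt 𝓘(ℝ, E) E (verticalPartAux D γ w) γ.1 where
  smul {f Y} hf hY := by
    have hfπ : MDifferentiableAt (cotangentModel E) 𝓘(ℝ, ℝ)
        (f ∘ (TotalSpace.proj : Cotangent E M → M)) γ := hf.comp γ (mdifferentiableAt_proj _)
    have e : evalField (E := E) (f • Y) = (f ∘ TotalSpace.proj) * evalField Y := by
      funext α
      simp [evalField]
    have e2 : mvfderiv (cotangentModel E) (f ∘ (TotalSpace.proj : Cotangent E M → M)) γ w
        = mvfderiv 𝓘(ℝ, E) f γ.1 (dproj γ w) := by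
      rw [mvfderiv_comp γ hf (mdifferentiableAt_proj _)]
      rfl
    simp only [verticalPartAux, D.isCovariantDerivativeOn.leibniz hY hf, e,
      mvfderiv_mul hfπ (mdifferentiableAt_evalField hY)]
    simp [e2, evalField]
    ring
  add {Y Y'} hY hY' := by
    have e : evalField (E := E) (Y + Y') = evalField Y + evalField Y' := by
      funext α
      simp [evalField]
    simp only [verticalPartAux, D.isCovariantDerivativeOn.add hY hY', e,
      mvfderiv_add (mdifferentiableAt_evalField hY) (mdifferentiableAt_evalField hY')]
    simp
    ring

variable [FiniteDimensional ℝ E]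

/-- The vertical part of a tangent vector `w` of `T*M` at `γ`, with respect to `D`: the covector
`y ↦ w(α ↦ α(Y)) - γ(D_{dπ(w)} Y)`, where `Y` is any vector field with value `y` at `π(γ)`. On a
vertical vector it is that covector itself, and if `s` is a `1`-form and `w = ds(v)`, it is
`y ↦ v(s(Y)) - s(D_v Y) = (D_v s)(y)`. Its kernel is the horizontal space of `D` at `γ`. -/
def verticalPart (D : Connection E M) (γ : Cotangent E M) :
    TangentSpace (cotangentModel E) γ →ₗ[ℝ] (TangentSpace 𝓘(ℝ, E) γ.1 →L[ℝ] ℝ) where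
  toFun w := TensorialAt.mkHom (verticalPartAux D γ w) γ.1 (tensorialAt_verticalPartAux D γ w)
  map_add' w w' := by
    ext y
    simp only [add_apply, TensorialAt.mkHom_apply_eq_extend, verticalPartAux,
      ContinuousLinearMap.map_add]
    ring
  map_smul' c w := by
    ext y
    simp only [smul_apply, TensorialAt.mkHom_apply_eq_extend, verticalPartAux,
      ContinuousLinearMap.map_smul, RingHom.id_apply, smul_eq_mul]
    ring

/-- `w ↦ (dπ(w), vertical part of w)`. -/
def splittingMap (D : Connection E M) (γ : Cotangent E M) :
    TangentSpace (cotangentModel E) γ →ₗ[ℝ]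
      TangentSpace 𝓘(ℝ, E) γ.1 × (TangentSpace 𝓘(ℝ, E) γ.1 →L[ℝ] ℝ) :=
  LinearMap.prod (dproj γ).toLinearMap (verticalPart D γ)

lemma splittingMap_injective (D : Connection E M) (γ : Cotangent E M) :
    Function.Injective (splittingMap D γ) := by
  rw [injective_iff_map_eq_zero]
  intro w hw
  have h1 : dproj γ w = 0 := congrArg Prod.fst hw
  have h2 : verticalPart D γ w = 0 := congrArg Prod.snd hw
  have h3 : ∀ y : TangentSpace 𝓘(ℝ, E) γ.1,
      mvfderiv (cotangentModel E) (evalField (E := E) (FiberBundle.extend E y)) γ w = 0 := by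
    intro y
    have h4 : verticalPartAux D γ w (FiberBundle.extend E y) = 0 :=
      congrArg (fun φ : TangentSpace 𝓘(ℝ, E) γ.1 →L[ℝ] ℝ => φ y) h2
    rw [verticalPartAux, h1, ContinuousLinearMap.map_zero, ContinuousLinearMap.map_zero,
      sub_zero] at h4
    exact h4
  -- Read `w` in the bundle chart centred at `γ`.
  set c : Cotangent E M → E × (E →L[ℝ] ℝ) := fun α => extChartAt (cotangentModel E) γ α with hc
  have hcd : MDifferentiableAt (cotangentModel E) 𝓘(ℝ, E × (E →L[ℝ] ℝ)) c γ :=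
    mdifferentiableAt_extChartAt (mem_chart_source _ γ)
  have hcw : mvfderiv (cotangentModel E) c γ w = 0 := by
    refine Prod.ext ?_ ?_
    · have e : ContinuousLinearMap.fst ℝ E (E →L[ℝ] ℝ) ∘ c
          = extChartAt 𝓘(ℝ, E) γ.1 ∘ (TotalSpace.proj : Cotangent E M → M) := by
        funext α
        rfl
      have h5 := mvfderiv_clm_comp hcd (ContinuousLinearMap.fst ℝ E (E →L[ℝ] ℝ)) w
      rw [e, mvfderiv, mfderiv_comp (I' := 𝓘(ℝ, E)) γ
        (mdifferentiableAt_extChartAt (mem_chart_source _ γ.1)) (mdifferentiableAt_proj _)] at h5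
      have h6 : mfderiv (cotangentModel E) 𝓘(ℝ, E) (TotalSpace.proj : Cotangent E M → M) γ w = 0 := h1
      rw [ContinuousLinearMap.comp_apply, ContinuousLinearMap.comp_apply, h6] at h5
      exact h5.symm.trans ((congrArg _ (ContinuousLinearMap.map_zero _)).trans
        (map_zero (NormedSpace.fromTangentSpace _)))
    · ext e
      have hx := FiberBundle.mem_baseSet_trivializationAt' (F := E)
        (E := fun x : M => TangentSpace 𝓘(ℝ, E) x) γ.1
      set t := trivializationAt E (fun x : M => TangentSpace 𝓘(ℝ, E) x) γ.1 with ht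
      let A : E × (E →L[ℝ] ℝ) →L[ℝ] ℝ :=
        (ContinuousLinearMap.apply ℝ ℝ e).comp (ContinuousLinearMap.snd ℝ E (E →L[ℝ] ℝ))
      have e7 : A ∘ c =ᶠ[𝓝 γ] evalField (E := E) (FiberBundle.extend E (t.symm γ.1 e)) := by
        have hU : (TotalSpace.proj : Cotangent E M → M) ⁻¹' t.baseSet ∈ 𝓝 γ :=
          (FiberBundle.continuous_proj (E →L[ℝ] ℝ)
            (fun x : M => TangentSpace 𝓘(ℝ, E) x →L[ℝ] ℝ)).continuousAt.preimage_mem_nhds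
            (t.open_baseSet.mem_nhds hx)
        filter_upwards [hU] with α hα
        have h8 : (A ∘ c) α = α.2 (t.symmL ℝ α.1 e) := by
          have h11 : (A ∘ c) α = (trivializationAt ℝ (Bundle.Trivial M ℝ) γ.1).continuousLinearMapAt
            ℝ α.1 (α.2 (t.symmL ℝ α.1 e)) := rfl
          rw [h11]
          simp
        rw [h8, t.symmL_apply hα]
        simp [evalField, FiberBundle.extend, ← ht, t.apply_mk_symm hx]
      have h9 := mvfderiv_clm_comp hcd A w
      rw [mvfderiv, e7.mfderiv_eq] at h9
      exact h9.symm.trans (h3 (t.symm γ.1 e))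
  have hinv := isInvertible_mfderiv_extChartAt (I := cotangentModel E) (mem_extChartAt_source γ)
  obtain ⟨f, hf⟩ := hinv
  have h10 : f w = 0 := by
    have : mfderiv (cotangentModel E) 𝓘(ℝ, E × (E →L[ℝ] ℝ)) c γ w = 0 := hcw
    rw [← this]
    exact congrArg (fun φ => φ w) hf
  exact f.map_eq_zero_iff.1 h10

lemma splittingMap_bijective (D : Connection E M) (γ : Cotangent E M) :
    Function.Bijective (splittingMap D γ) := by
  have i1 : FiniteDimensional ℝ (TangentSpace (cotangentModel E) γ) :=
    inferInstanceAs (FiniteDimensional ℝ (E × (E →L[ℝ] ℝ)))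
  have i2 : FiniteDimensional ℝ (TangentSpace 𝓘(ℝ, E) γ.1 × (TangentSpace 𝓘(ℝ, E) γ.1 →L[ℝ] ℝ)) :=
    inferInstanceAs (FiniteDimensional ℝ (E × (E →L[ℝ] ℝ)))
  have hdim : Module.finrank ℝ (TangentSpace (cotangentModel E) γ) =
      Module.finrank ℝ (TangentSpace 𝓘(ℝ, E) γ.1 × (TangentSpace 𝓘(ℝ, E) γ.1 →L[ℝ] ℝ)) := rfl
  exact ⟨splittingMap_injective D γ,
    (LinearMap.injective_iff_surjective_of_finrank_eq_finrank hdim).1 (splittingMap_injective D γ)⟩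

/-- The identification `T_γ(T*M) = T_xM ⊕ T_x*M`, `x = π(γ)`, defined by `D`: the horizontal space
is identified with `T_xM` by `dπ`, and the vertical space is `T_x*M`. -/
def splitting (D : Connection E M) (γ : Cotangent E M) :
    TangentSpace (cotangentModel E) γ ≃L[ℝ]
      TangentSpace 𝓘(ℝ, E) γ.1 × (TangentSpace 𝓘(ℝ, E) γ.1 →L[ℝ] ℝ) :=
  haveI : T2Space (TangentSpace (cotangentModel E) γ) := inferInstanceAs (T2Space (E × (E →L[ℝ] ℝ)))
  haveI : FiniteDimensional ℝ (TangentSpace (cotangentModel E) γ) :=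
    inferInstanceAs (FiniteDimensional ℝ (E × (E →L[ℝ] ℝ)))
  haveI : T2Space (TangentSpace 𝓘(ℝ, E) γ.1 × (TangentSpace 𝓘(ℝ, E) γ.1 →L[ℝ] ℝ)) :=
    inferInstanceAs (T2Space (E × (E →L[ℝ] ℝ)))
  (LinearEquiv.ofBijective (splittingMap D γ) (splittingMap_bijective D γ)).toContinuousLinearEquiv

/-- The almost complex structure `π^*𝒥` on `T*M` defined by a connection `D` and a generalized
complex structure `𝒥`, a field of endomorphisms of `TM ⊕ T*M`. -/
def inducedStructure (D : Connection E M)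
    (𝒥 : ∀ x : M, (TangentSpace 𝓘(ℝ, E) x × (TangentSpace 𝓘(ℝ, E) x →L[ℝ] ℝ)) →L[ℝ]
      (TangentSpace 𝓘(ℝ, E) x × (TangentSpace 𝓘(ℝ, E) x →L[ℝ] ℝ)))
    (γ : Cotangent E M) :
    TangentSpace (cotangentModel E) γ →L[ℝ] TangentSpace (cotangentModel E) γ :=
  ((splitting D γ).symm.toContinuousLinearMap.comp (𝒥 γ.1)).comp
    (splitting D γ).toContinuousLinearMap

/-- The generalized complex structure `J ⊕ εJ*` on `TM ⊕ T*M`, where `J*ξ = ξ ∘ J`, so that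
`εJ*ξ = ξ ∘ (εJ)`. -/
def diagonalStructure (ε : ℝ) (J : ∀ x : M, TangentSpace 𝓘(ℝ, E) x →L[ℝ] TangentSpace 𝓘(ℝ, E) x)
    (x : M) : (TangentSpace 𝓘(ℝ, E) x × (TangentSpace 𝓘(ℝ, E) x →L[ℝ] ℝ)) →L[ℝ]
      (TangentSpace 𝓘(ℝ, E) x × (TangentSpace 𝓘(ℝ, E) x →L[ℝ] ℝ)) :=
  (J x).prodMap (ContinuousLinearMap.precomp ℝ (ε • J x))

/-- The almost complex structure `J⁺` on `T*M` defined by `D` and `J ⊕ J*`. -/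
def Jplus (D : Connection E M)
    (J : ∀ x : M, TangentSpace 𝓘(ℝ, E) x →L[ℝ] TangentSpace 𝓘(ℝ, E) x) (γ : Cotangent E M) :
    TangentSpace (cotangentModel E) γ →L[ℝ] TangentSpace (cotangentModel E) γ :=
  inducedStructure D (diagonalStructure 1 J) γ

/-- The almost complex structure `J⁻` on `T*M` defined by `D` and `J ⊕ (-J*)`. -/
def Jminus (D : Connection E M)
    (J : ∀ x : M, TangentSpace 𝓘(ℝ, E) x →L[ℝ] TangentSpace 𝓘(ℝ, E) x) (γ : Cotangent E M) :
    TangentSpace (cotangentModel E) γ →L[ℝ] TangentSpace (cotangentModel E) γ :=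
  inducedStructure D (diagonalStructure (-1) J) γ

end Cotangent

/-! ## Connections, metrics and complex structures on `M` -/

section Structures

variable {E : Type*} [NormedAddCommGroup E] [NormedSpace ℝ E]
  {M : Type*} [TopologicalSpace M] [ChartedSpace E M] [IsManifold 𝓘(ℝ, E) ∞ M]

/-- The curvature `R(X, Y)Z = -D_X D_Y Z + D_Y D_X Z + D_{[X,Y]} Z`. -/
def curvature (D : Connection E M) (X Y Z : ∀ x : M, TangentSpace 𝓘(ℝ, E) x) (x : M) :
    TangentSpace 𝓘(ℝ, E) x :=
  -D (fun y => D Z y (Y y)) x (X x) + D (fun y => D Z y (X y)) x (Y x)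
    + D Z x (VectorField.mlieBracket 𝓘(ℝ, E) X Y x)

/-- `(D_X J)(Y) = D_X (JY) - J (D_X Y)`. -/
def derivEnd (D : Connection E M)
    (J : ∀ x : M, TangentSpace 𝓘(ℝ, E) x →L[ℝ] TangentSpace 𝓘(ℝ, E) x)
    (X Y : ∀ x : M, TangentSpace 𝓘(ℝ, E) x) (x : M) : TangentSpace 𝓘(ℝ, E) x :=
  D (fun y => J y (Y y)) x (X x) - J x (D Y x (X x))

/-- The curvature of `D` vanishes. -/
def IsFlat (D : Connection E M) : Prop :=
  ∀ (X Y Z : ∀ x : M, TangentSpace 𝓘(ℝ, E) x) (x : M),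
    SmoothFieldAt 𝓘(ℝ, E) X x → SmoothFieldAt 𝓘(ℝ, E) Y x → SmoothFieldAt 𝓘(ℝ, E) Z x →
      curvature D X Y Z x = 0

/-- The torsion of `D` vanishes. -/
def IsTorsionFree [FiniteDimensional ℝ E] (D : Connection E M) : Prop :=
  haveI : CompleteSpace E := FiniteDimensional.complete ℝ E
  D.torsion = 0

/-- `(J, D)` is a special complex structure: `J` is integrable, `D` is flat and torsion-free, and
`(d^D J)(X, Y) = (D_X J)(Y) - (D_Y J)(X)` vanishes. -/
structure IsSpecialComplex [FiniteDimensional ℝ E] (D : Connection E M)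
    (J : ∀ x : M, TangentSpace 𝓘(ℝ, E) x →L[ℝ] TangentSpace 𝓘(ℝ, E) x) : Prop where
  integrable : IsIntegrable 𝓘(ℝ, E) J
  flat : IsFlat D
  torsionFree : IsTorsionFree D
  deriv_symm : ∀ (X Y : ∀ x : M, TangentSpace 𝓘(ℝ, E) x) (x : M),
    SmoothFieldAt 𝓘(ℝ, E) X x → SmoothFieldAt 𝓘(ℝ, E) Y x →
      derivEnd D J X Y x - derivEnd D J Y X x = 0

variable (E M) in
/-- Smooth Riemannian metrics on `M`. -/
abbrev SmoothMetric : Type _ :=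
  ContMDiffRiemannianMetric 𝓘(ℝ, E) ∞ E (fun x : M => TangentSpace 𝓘(ℝ, E) x)

/-- `D` is compatible with the metric `g`, that is `Dg = 0`. -/
def IsMetric (g : SmoothMetric E M) (D : Connection E M) : Prop :=
  ∀ (X Y Z : ∀ x : M, TangentSpace 𝓘(ℝ, E) x) (x : M),
    SmoothFieldAt 𝓘(ℝ, E) X x → SmoothFieldAt 𝓘(ℝ, E) Y x → SmoothFieldAt 𝓘(ℝ, E) Z x →
      mvfderiv 𝓘(ℝ, E) (fun y => g.inner y (Y y) (Z y)) x (X x) =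
        g.inner x (D Y x (X x)) (Z x) + g.inner x (Y x) (D Z x (X x))

/-- `D` is the Levi-Civita connection of `g`. -/
structure IsLeviCivita [FiniteDimensional ℝ E] (g : SmoothMetric E M)
    (D : Connection E M) : Prop where
  metric : IsMetric g D
  torsionFree : IsTorsionFree D

/-- `(g, J)` is an almost Hermitian structure. -/
structure IsAlmostHermitian (g : SmoothMetric E M)
    (J : ∀ x : M, TangentSpace 𝓘(ℝ, E) x →L[ℝ] TangentSpace 𝓘(ℝ, E) x) : Prop where
  almostComplex : IsAlmostComplex 𝓘(ℝ, E) J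
  compatible : ∀ (x : M) (u v : TangentSpace 𝓘(ℝ, E) x),
    g.inner x (J x u) (J x v) = g.inner x u v

/-- `(g, J)` is a Hermitian structure: almost Hermitian, with `J` integrable. -/
structure IsHermitian (g : SmoothMetric E M)
    (J : ∀ x : M, TangentSpace 𝓘(ℝ, E) x →L[ℝ] TangentSpace 𝓘(ℝ, E) x) : Prop
    extends IsAlmostHermitian g J where
  integrable : IsIntegrable 𝓘(ℝ, E) J

/-- The function `ω(X, Y) = g(JX, Y)`. -/
def fundamentalForm (g : SmoothMetric E M)
    (J : ∀ x : M, TangentSpace 𝓘(ℝ, E) x →L[ℝ] TangentSpace 𝓘(ℝ, E) x)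
    (X Y : ∀ x : M, TangentSpace 𝓘(ℝ, E) x) (x : M) : ℝ :=
  g.inner x (J x (X x)) (Y x)

/-- The exterior differential of the fundamental form `ω`:
`dω(X, Y, Z) = X(ω(Y, Z)) - Y(ω(X, Z)) + Z(ω(X, Y)) - ω([X, Y], Z) + ω([X, Z], Y) - ω([Y, Z], X)`.
-/
def dFundamentalForm (g : SmoothMetric E M)
    (J : ∀ x : M, TangentSpace 𝓘(ℝ, E) x →L[ℝ] TangentSpace 𝓘(ℝ, E) x)
    (X Y Z : ∀ x : M, TangentSpace 𝓘(ℝ, E) x) (x : M) : ℝ :=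
  mvfderiv 𝓘(ℝ, E) (fundamentalForm g J Y Z) x (X x)
    - mvfderiv 𝓘(ℝ, E) (fundamentalForm g J X Z) x (Y x)
    + mvfderiv 𝓘(ℝ, E) (fundamentalForm g J X Y) x (Z x)
    - fundamentalForm g J (VectorField.mlieBracket 𝓘(ℝ, E) X Y) Z x
    + fundamentalForm g J (VectorField.mlieBracket 𝓘(ℝ, E) X Z) Y x
    - fundamentalForm g J (VectorField.mlieBracket 𝓘(ℝ, E) Y Z) X x

/-- `(g, J)` is Kähler: Hermitian, with closed fundamental form. -/
structure IsKaehler (g : SmoothMetric E M)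
    (J : ∀ x : M, TangentSpace 𝓘(ℝ, E) x →L[ℝ] TangentSpace 𝓘(ℝ, E) x) : Prop
    extends IsHermitian g J where
  closed : ∀ (X Y Z : ∀ x : M, TangentSpace 𝓘(ℝ, E) x) (x : M),
    SmoothFieldAt 𝓘(ℝ, E) X x → SmoothFieldAt 𝓘(ℝ, E) Y x → SmoothFieldAt 𝓘(ℝ, E) Z x →
      dFundamentalForm g J X Y Z x = 0

/-- `D` is the Chern connection of the Hermitian structure `(g, J)`: `Dg = 0`, `DJ = 0`, and the
`(0,1)`-part of `D` is the Dolbeault operator of the holomorphic bundle `(TM, J)`. The latter reads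
`(D_X Y + J D_{JX} Y) / 2 = ([X, Y] + J [JX, Y]) / 2`, the right-hand side being the operator that
vanishes for all `X` exactly when the field `Y` is holomorphic (`L_Y J = 0`). -/
structure IsChern (g : SmoothMetric E M)
    (J : ∀ x : M, TangentSpace 𝓘(ℝ, E) x →L[ℝ] TangentSpace 𝓘(ℝ, E) x)
    (D : Connection E M) : Prop where
  metric : IsMetric g D
  parallel : ∀ (X Y : ∀ x : M, TangentSpace 𝓘(ℝ, E) x) (x : M),
    SmoothFieldAt 𝓘(ℝ, E) X x → SmoothFieldAt 𝓘(ℝ, E) Y x → derivEnd D J X Y x = 0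
  dolbeault : ∀ (X Y : ∀ x : M, TangentSpace 𝓘(ℝ, E) x) (x : M),
    SmoothFieldAt 𝓘(ℝ, E) X x → SmoothFieldAt 𝓘(ℝ, E) Y x →
      D Y x (X x) + J x (D Y x (J x (X x))) =
        VectorField.mlieBracket 𝓘(ℝ, E) X Y x
          + J x (VectorField.mlieBracket 𝓘(ℝ, E) (fun y => J y (X y)) Y x)

end Structures

end SpecialGeometry

end

open SpecialGeometry

/-! Write `J^ε` for the structure on `T*M` defined by `J ⊕ εJ*`, with `ε = ±1`. Its Nijenhuis tensor
at `γ` depends only on the values of the two fields there, so it can be computed on lifts: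
horizontal lift of a field `X` plus vertical lift of a `1`-form `α`. The bracket of two lifts is
found by letting it act on two kinds of functions: pull-backs from `M`, which show that it projects
to `[X, Y]`, and the functions `α ↦ α(Z)`, which show that its vertical part is `-γ(R(X,Y)Z) + (D_X
β)(Z) - (D_Y α)(Z)`. Lifts are stable under `J^ε`, so the Nijenhuis tensor follows
(`dproj_nijenhuis_lift`, `verticalPart_nijenhuis_lift`).

The entries `γ`, `α`, `β` can be chosen independently, hence `J^ε` is integrable if and only if
three conditions hold on `M`: (a) `N_J = 0`; (b) `ε (D_{JX}J) Z + J (D_X J) Z = 0`; (c) `R(X,Y)Z -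
R(JX,JY)Z + ε (R(JX,Y) + R(X,JY)) JZ = 0`.

What remains is tensor algebra. Special complex: (c) is flatness, and (b) follows from the symmetry
of `DJ` because `D_X J` anticommutes with `J`. Levi-Civita: `N_J = 0` forces `D_{JX}J = J D_X J`
(`Algebraic.dEnd_J_of_nij`). This is (b) for `ε = -1`, while for `ε = 1` it turns (b) into `DJ = 0`,
the Kähler condition; (c) for `ε = 1` then follows from the pair symmetry of the curvature. Chern:
(b) is trivial. For `ε = 1`, (c) says that the `(0,2)`-part of the curvature vanishes, which holds
because the Dolbeault operator squares to zero (`Algebraic.curv_dolbeault`); for `ε = -1` it is the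
metric adjoint of that statement (`Algebraic.curv_dolbeault_neg`). -/

namespace SpecialGeometry

open VectorField

/-! ### The Lie bracket as a commutator of derivations. -/

section Bracket

/-- The Lie bracket acts on functions as the commutator of derivations, in a normed space. -/
lemma fderiv_lieBracket {E F : Type*} [NormedAddCommGroup E] [NormedSpace ℝ E]
    [NormedAddCommGroup F] [NormedSpace ℝ F] {f : E → F} {V W : E → E} {x : E}
    (hf : ContDiffAt ℝ 2 f x) (hV : DifferentiableAt ℝ V x) (hW : DifferentiableAt ℝ W x) :
    fderiv ℝ f x (lieBracket ℝ V W x) =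
      fderiv ℝ (fun y => fderiv ℝ f y (W y)) x (V x)
        - fderiv ℝ (fun y => fderiv ℝ f y (V y)) x (W x) := by
  have hd : DifferentiableAt ℝ (fderiv ℝ f) x :=
    (hf.fderiv_right (m := 1) (by norm_num)).differentiableAt (by norm_num)
  have hs := hf.isSymmSndFDerivAt (by simp)
  rw [fderiv_clm_apply hd hW, fderiv_clm_apply hd hV]
  simp only [lieBracket, map_sub, add_apply, ContinuousLinearMap.comp_apply,
    ContinuousLinearMap.flip_apply]
  rw [hs.eq (V x) (W x)]
  abel

variable {E : Type*} [NormedAddCommGroup E] [NormedSpace ℝ E]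
  {H : Type*} [TopologicalSpace H] {I : ModelWithCorners ℝ E H} [I.Boundaryless]
  {M : Type*} [TopologicalSpace M] [ChartedSpace H M] [IsManifold I ∞ M]
  {F : Type*} [NormedAddCommGroup F] [NormedSpace ℝ F]

/-- The derivative of the inverse chart is invertible, so it cancels against the inverse that
defines the pulled-back field. This moves the commutator formula from `M` to the model space. -/
lemma mvfderiv_extChartAt_symm {f : M → F} {x : M} {y : E} 
    (hy : y ∈ (extChartAt I x).target)
    (hf : MDifferentiableAt I 𝓘(ℝ, F) f ((extChartAt I x).symm y))
    (W : ∀ x : M, TangentSpace I x) :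
    mvfderiv I f ((extChartAt I x).symm y) (W ((extChartAt I x).symm y)) =
      fderiv ℝ (f ∘ (extChartAt I x).symm) y
        (mpullbackWithin 𝓘(ℝ, E) I (extChartAt I x).symm W (Set.range I) y) := by
  have hinv := isInvertible_mfderivWithin_extChartAt_symm (I := I) hy
  have hd : MDifferentiableAt 𝓘(ℝ, E) I (extChartAt I x).symm y :=
    ((contMDiffOn_extChartAt_symm (n := 1) x).contMDiffAt
      ((isOpen_extChartAt_target x).mem_nhds hy)).mdifferentiableAt (by simp)
  rw [mpullbackWithin_apply]
  rw [I.range_eq_univ, mfderivWithin_univ] at hinv ⊢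
  have h1 : fderiv ℝ (f ∘ (extChartAt I x).symm) y =
     (mfderiv I 𝓘(ℝ, F) f ((extChartAt I x).symm y)).comp
      (mfderiv 𝓘(ℝ, E) I (extChartAt I x).symm y) := by
    rw [← mfderiv_comp y hf hd, mfderiv_eq_fderiv]
  rw [h1]
  obtain ⟨e, he⟩ := hinv
  rw [← he, ContinuousLinearMap.inverse_equiv]
  change _ = mfderiv I 𝓘(ℝ, F) f ((extChartAt I x).symm y) (e (e.symm _))
  rw [e.apply_symm_apply]
  rfl

lemma inverse_apply_of_eq_id {E : Type*} [NormedAddCommGroup E] [NormedSpace ℝ E]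
    {A : E →L[ℝ] E} (hA : A = ContinuousLinearMap.id ℝ E) (v : E) : A.inverse v = v := by
  simp [hA]

/-- The Lie bracket of vector fields on a manifold acts on functions as the commutator of
derivations. -/
lemma mvfderiv_mlieBracket [CompleteSpace E] {f : M → F} {V W : ∀ x : M, TangentSpace I x} {x : M}
    (hf : ContMDiffAt I 𝓘(ℝ, F) 2 f x)
    (hV : MDifferentiableAt I I.tangent (fun y => (⟨y, V y⟩ : TangentBundle I M)) x)
    (hW : MDifferentiableAt I I.tangent (fun y => (⟨y, W y⟩ : TangentBundle I M)) x) :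
    mvfderiv I f x (mlieBracket I V W x) =
      mvfderiv I (fun y => mvfderiv I f y (W y)) x (V x)
        - mvfderiv I (fun y => mvfderiv I f y (V y)) x (W x) := by
  set φ := extChartAt I x with hφ
  set V' := mpullbackWithin 𝓘(ℝ, E) I φ.symm V (Set.range I) with hV'
  set W' := mpullbackWithin 𝓘(ℝ, E) I φ.symm W (Set.range I) with hW'
  have hx : φ x ∈ φ.target := mem_extChartAt_target x
  have hxx : φ.symm (φ x) = x := extChartAt_to_inv x
  have hFd : ContDiffAt ℝ 2 (f ∘ φ.symm) (φ x) := by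
    rw [← contMDiffAt_iff_contDiffAt]
    refine ContMDiffAt.comp (I' := I) _ (by rw [hxx]; exact hf) ?_
    exact (contMDiffOn_extChartAt_symm x).contMDiffAt
      ((isOpen_extChartAt_target x).mem_nhds hx)
  have hφd : MDifferentiableAt I 𝓘(ℝ, E) φ x := mdifferentiableAt_extChartAt (mem_chart_source _ x)
  have hdiff : ∀ {U : ∀ x : M, TangentSpace I x},
      MDifferentiableAt I I.tangent (fun y => (⟨y, U y⟩ : TangentBundle I M)) x →
      DifferentiableAt ℝ (mpullbackWithin 𝓘(ℝ, E) I φ.symm U (Set.range I)) (φ x) := by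
    intro U hU
    have h := MDifferentiableWithinAt.differentiableWithinAt_mpullbackWithin_vectorField
      (mdifferentiableWithinAt_univ.2 hU)
    exact h.differentiableAt (by simp [I.range_eq_univ])
  -- a function which agrees with `G ∘ φ` near `x`
  have key : ∀ {g : M → F} {G : E → F}, DifferentiableAt ℝ G (φ x) → g =ᶠ[𝓝 x] G ∘ φ →
      ∀ v : TangentSpace I x, mvfderiv I g x v = fderiv ℝ G (φ x) v := by
    intro g G hG hg v
    rw [mvfderiv, hg.mfderiv_eq, mfderiv_comp (I' := 𝓘(ℝ, E)) x hG.mdifferentiableAt hφd,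
      hφ, mfderiv_extChartAt_self, mfderiv_eq_fderiv]
    rfl
  -- A chart has derivative the identity at its own centre, so pulling back to the chart at `x` does
  -- not change values at `x`.
  have hval : ∀ U : ∀ x : M, TangentSpace I x,
      mpullbackWithin 𝓘(ℝ, E) I φ.symm U (Set.range I) (φ x) = U x := by
    intro U
    exact (inverse_apply_of_eq_id (E := E) mfderivWithin_range_extChartAt_symm _).trans
      (congrArg (fun y => (U y : E)) hxx)
  have hsrc : ∀ᶠ y in 𝓝 x, y ∈ φ.source := extChartAt_source_mem_nhds x
  have hev : ∀ᶠ y in 𝓝 x, MDifferentiableAt I 𝓘(ℝ, F) f y := by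
    filter_upwards [(contMDiffAt_iff_contMDiffAt_nhds (by simp)).1 hf] with y hy
    exact hy.mdifferentiableAt (by simp)
  have hloc : ∀ U : ∀ x : M, TangentSpace I x, (fun y => mvfderiv I f y (U y)) =ᶠ[𝓝 x]
      (fun z => fderiv ℝ (f ∘ φ.symm) z
        (mpullbackWithin 𝓘(ℝ, E) I φ.symm U (Set.range I) z)) ∘ φ := by
    intro U
    filter_upwards [hsrc, hev] with y hy hfy
    have h := mvfderiv_extChartAt_symm (φ.map_source hy)
      (by rw [φ.left_inv hy]; exact hfy) U
    rw [φ.left_inv hy] at h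
    exact h
  have hfd' : DifferentiableAt ℝ (fderiv ℝ (f ∘ φ.symm)) (φ x) :=
    (hFd.fderiv_right (m := 1) (by norm_num)).differentiableAt (by norm_num)
  rw [key (hfd'.clm_apply (hdiff hW)) (hloc W), key (hfd'.clm_apply (hdiff hV)) (hloc V),
    key (G := f ∘ φ.symm) (hFd.differentiableAt (by norm_num)) (by
      filter_upwards [hsrc] with y hy
      simp [φ.left_inv hy])]
  have hbr : mlieBracket I V W x = lieBracket ℝ V' W' (φ x) := by
    rw [← mlieBracketWithin_univ, mlieBracketWithin_apply]
    refine (inverse_apply_of_eq_id (E := E) mfderiv_extChartAt_self _).trans ?_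
    have hs : φ.symm ⁻¹' Set.univ ∩ Set.range I = Set.univ := by simp [I.range_eq_univ]
    exact (congrArg (fun s => lieBracketWithin ℝ V' W' s (φ x)) hs).trans
      (congrFun lieBracketWithin_univ _)
  rw [hbr, fderiv_lieBracket hFd (hdiff hV) (hdiff hW), hval V, hval W]

end Bracket

/-! ### Smoothness criteria for sections, endomorphism fields and derivatives. -/

section Smoothness

variable {E : Type*} [NormedAddCommGroup E] [NormedSpace ℝ E]
  {H : Type*} [TopologicalSpace H] {I : ModelWithCorners ℝ E H}
  {M : Type*} [TopologicalSpace M] [ChartedSpace H M]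
  {F₁ F₂ : Type*} [NormedAddCommGroup F₁] [NormedSpace ℝ F₁]
  [NormedAddCommGroup F₂] [NormedSpace ℝ F₂]

/-- A family of linear maps on a finite-dimensional space is smooth if it is pointwise smooth. -/
lemma contMDiffAt_clm_of_apply [FiniteDimensional ℝ F₁] {n : ℕ∞ω} {f : M → F₁ →L[ℝ] F₂} {x : M}
    (h : ∀ e, ContMDiffAt I 𝓘(ℝ, F₂) n (fun y => f y e) x) :
    ContMDiffAt I 𝓘(ℝ, F₁ →L[ℝ] F₂) n f x := by
  let b := Module.finBasis ℝ F₁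
  let e₁ : F₁ ≃L[ℝ] Fin (Module.finrank ℝ F₁) → ℝ := b.equivFun.toContinuousLinearEquiv
  let L : (F₁ →L[ℝ] F₂) ≃L[ℝ] (Fin (Module.finrank ℝ F₁) → F₂) :=
    (e₁.arrowCongr (ContinuousLinearEquiv.refl ℝ F₂)).trans
      (ContinuousLinearEquiv.piRing (Fin (Module.finrank ℝ F₁)))
  have hL : ContMDiffAt I 𝓘(ℝ, Fin (Module.finrank ℝ F₁) → F₂) n (fun y => L (f y)) x := by
    rw [contMDiffAt_pi_space]
    intro i
    exact h (e₁.symm (Pi.single i 1))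
  have := (L.symm.contDiff (n := n)).contMDiff.contMDiffAt.comp x hL
  refine this.congr_of_eventuallyEq (Filter.Eventually.of_forall fun y => ?_)
  exact (L.symm_apply_apply (f y)).symm

section Hom

variable {E₁ E₂ : M → Type*} [∀ x, AddCommGroup (E₁ x)] [∀ x, Module ℝ (E₁ x)]
  [TopologicalSpace (TotalSpace F₁ E₁)] [∀ x, TopologicalSpace (E₁ x)]
  [∀ x, AddCommGroup (E₂ x)] [∀ x, Module ℝ (E₂ x)]
  [TopologicalSpace (TotalSpace F₂ E₂)] [∀ x, TopologicalSpace (E₂ x)]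
  [FiberBundle F₁ E₁] [VectorBundle ℝ F₁ E₁] [FiberBundle F₂ E₂] [VectorBundle ℝ F₂ E₂]
  [∀ x, IsTopologicalAddGroup (E₂ x)] [∀ x, ContinuousSMul ℝ (E₂ x)]

/-- A section of a bundle of homomorphisms is smooth if it maps the local extensions of vectors to
smooth sections. -/
lemma contMDiffAt_hom_of_extend [FiniteDimensional ℝ F₁] {n : ℕ∞ω}
    {Φ : ∀ x : M, E₁ x →L[ℝ] E₂ x} {x : M}
    (h : ∀ v : E₁ x, ContMDiffAt I (I.prod 𝓘(ℝ, F₂)) n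
      (fun y => TotalSpace.mk' F₂ y (Φ y (FiberBundle.extend F₁ v y))) x) :
    ContMDiffAt I (I.prod 𝓘(ℝ, F₁ →L[ℝ] F₂)) n
      (fun y => TotalSpace.mk' (F₁ →L[ℝ] F₂) (E := fun y => E₁ y →L[ℝ] E₂ y) y (Φ y)) x := by
  rw [contMDiffAt_hom_bundle]
  refine ⟨contMDiffAt_id, contMDiffAt_clm_of_apply fun e => ?_⟩
  set t := trivializationAt F₁ E₁ x with ht
  have hx := FiberBundle.mem_baseSet_trivializationAt' (F := F₁) (E := E₁) x
  have hx₂ := FiberBundle.mem_baseSet_trivializationAt' (F := F₂) (E := E₂) x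
  have h1 := h (t.symm x e)
  rw [contMDiffAt_totalSpace] at h1
  refine h1.2.congr_of_eventuallyEq ?_
  filter_upwards [t.open_baseSet.mem_nhds hx,
    (trivializationAt F₂ E₂ x).open_baseSet.mem_nhds hx₂] with y hy hy₂
  -- The local extension has constant coordinates `e` in the trivialization at `x`, so its image has
  -- as coordinates the matrix of `Φ` applied to `e`.
  have h2 : FiberBundle.extend F₁ (t.symm x e) y = t.symm y e := by
    simp [FiberBundle.extend, ← ht, t.apply_mk_symm hx]
  simp only [h2]
  rw [ContinuousLinearMap.inCoordinates_eq hy hy₂]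
  simp [← ht]

end Hom

variable [IsManifold I ∞ M]

/-- Near `x`, the trivialization of the tangent bundle at `x` is the derivative of the chart at `x`.
Smoothness of a field on `T*M` can therefore be tested on the coordinates of the bundle chart. -/
lemma smoothFieldAt_iff {V : ∀ x : M, TangentSpace I x} {x : M} :
    SmoothFieldAt I V x ↔
      ContMDiffAt I 𝓘(ℝ, E) ∞ (fun y => mvfderiv I (extChartAt I x) y (V y)) x := by
  rw [SmoothFieldAt, contMDiffAt_section]
  refine Filter.EventuallyEq.contMDiffAt_iff ?_
  filter_upwards [(chartAt H x).open_source.mem_nhds (mem_chart_source H x)] with y hy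
  have h := TangentBundle.continuousLinearMapAt_trivializationAt (I := I) hy
  have h2 : (trivializationAt E (TangentSpace I) x ⟨y, V y⟩).2 =
      (trivializationAt E (TangentSpace I) x).continuousLinearMapAt ℝ y (V y) := by
    rw [Trivialization.continuousLinearMapAt_apply, Trivialization.linearMapAt_apply,
      if_pos (by simpa using hy)]
  rw [h2, h]
  rfl

section Map

variable {E' : Type*} [NormedAddCommGroup E'] [NormedSpace ℝ E']
  {H' : Type*} [TopologicalSpace H'] {I' : ModelWithCorners ℝ E' H'}
  {M' : Type*} [TopologicalSpace M'] [ChartedSpace H' M'] [IsManifold I' ∞ M']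

/-- The image of a smooth vector field under a smooth map is a smooth field along the map. -/
lemma ContMDiffAt.mfderiv_field {f : M → M'} {V : ∀ x : M, TangentSpace I x} {x : M}
    (hf : ContMDiffAt I I' ∞ f x) (hV : SmoothFieldAt I V x) :
    ContMDiffAt I I'.tangent ∞
      (fun y => (⟨f y, mfderiv I I' f y (V y)⟩ : TangentBundle I' M')) x := by
  have h := hf.mfderiv_const (m := ∞) (by simp)
  exact ContMDiffAt.clm_apply_of_inCoordinates (b₁ := id) (b₂ := f) h hV hf

end Map

/-- The derivative of a smooth function along a smooth vector field is smooth. -/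
lemma contMDiffAt_mvfderiv {f : M → F₁} {V : ∀ x : M, TangentSpace I x} {x : M}
    (hf : ContMDiffAt I 𝓘(ℝ, F₁) ∞ f x) (hV : SmoothFieldAt I V x) :
    ContMDiffAt I 𝓘(ℝ, F₁) ∞ (fun y => mvfderiv I f y (V y)) x := by
  have h := (contMDiffAt_totalSpace.1 (ContMDiffAt.mfderiv_field hf hV)).2
  simp only [trivializationAt_model_space_apply] at h
  exact h

lemma SmoothFieldAt.mdifferentiableAt {V : ∀ x : M, TangentSpace I x} {x : M}
    (hV : SmoothFieldAt I V x) :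
    MDifferentiableAt I I.tangent (fun y => (⟨y, V y⟩ : TangentBundle I M)) x :=
  ContMDiffAt.mdifferentiableAt hV (by simp)

lemma SmoothFieldAt.eventually {V : ∀ x : M, TangentSpace I x} {x : M}
    (hV : SmoothFieldAt I V x) : ∀ᶠ y in 𝓝 x,
    MDifferentiableAt I I.tangent (fun y => (⟨y, V y⟩ : TangentBundle I M)) y := by
  have h : ContMDiffAt I I.tangent 1 (fun y => (⟨y, V y⟩ : TangentBundle I M)) x :=
    ContMDiffAt.of_le hV (by simp)
  filter_upwards [(contMDiffAt_iff_contMDiffAt_nhds (by simp)).1 h] with y hy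
  exact hy.mdifferentiableAt (by simp)

end Smoothness

/-! ### The Nijenhuis tensor is a tensor. -/

section Tensoriality

variable {E : Type*} [NormedAddCommGroup E] [NormedSpace ℝ E]
  {H : Type*} [TopologicalSpace H] {I : ModelWithCorners ℝ E H}
  {M : Type*} [TopologicalSpace M] [ChartedSpace H M]

lemma nijenhuis_swap (J : ∀ x : M, TangentSpace I x →L[ℝ] TangentSpace I x)
    (X Y : ∀ x : M, TangentSpace I x) (x : M) :
    nijenhuis I J X Y x = -nijenhuis I J Y X x := by
  unfold nijenhuis
  rw [mlieBracket_swap_apply (V := fun y => J y (X y)) (W := fun y => J y (Y y)),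
    mlieBracket_swap_apply (V := fun y => J y (X y)) (W := Y),
    mlieBracket_swap_apply (V := X) (W := fun y => J y (Y y)),
    mlieBracket_swap_apply (V := X) (W := Y)]
  simp only [map_neg]
  abel

variable [IsManifold I ∞ M] {J : ∀ x : M, TangentSpace I x →L[ℝ] TangentSpace I x}

lemma IsAlmostComplex.smoothFieldAt (hJ : IsAlmostComplex I J) {X : ∀ x : M, TangentSpace I x}
    {x : M} (hX : SmoothFieldAt I X x) : SmoothFieldAt I (fun y => J y (X y)) x :=
  ContMDiffAt.clm_bundle_apply (E₁ := fun x : M => TangentSpace I x)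
    (E₂ := fun x : M => TangentSpace I x) (hJ.smooth x) hX

lemma IsAlmostComplex.mdifferentiableAt (hJ : IsAlmostComplex I J)
    {X : ∀ x : M, TangentSpace I x} {x : M}
    (hX : MDifferentiableAt I I.tangent (fun y => (⟨y, X y⟩ : TangentBundle I M)) x) :
    MDifferentiableAt I I.tangent (fun y => (⟨y, J y (X y)⟩ : TangentBundle I M)) x :=
  MDifferentiableAt.clm_bundle_apply (E₁ := fun x : M => TangentSpace I x)
    (E₂ := fun x : M => TangentSpace I x) ((hJ.smooth x).mdifferentiableAt (by simp)) hX

variable [CompleteSpace E]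

/-- Replacing `Y` by `fY` creates the terms `(JX f) JY` twice with opposite signs, and `-(Xf) J²Y -
(Xf) Y`, which vanishes because `J² = -1`. -/
lemma tensorialAt_nijenhuis_right (hJ : IsAlmostComplex I J) (X : ∀ x : M, TangentSpace I x)
    (x : M) : TensorialAt I E (fun Y => nijenhuis I J X Y x) x where
  smul {f Y} hf hY := by
    have hJY := hJ.mdifferentiableAt hY
    have e : (fun y => J y ((f • Y) y)) = f • fun y => J y (Y y) := by
      funext y
      simp
    simp only [nijenhuis, e, mlieBracket_smul_right hf hY, mlieBracket_smul_right hf hJY,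
      map_add, map_smul, hJ.sq]
    module
  add {Y Y'} hY hY' := by
    have hJY := hJ.mdifferentiableAt hY
    have hJY' := hJ.mdifferentiableAt hY'
    have e : (fun y => J y ((Y + Y') y)) = (fun y => J y (Y y)) + fun y => J y (Y' y) := by
      funext y
      simp
    simp only [nijenhuis, e, mlieBracket_add_right hY hY', mlieBracket_add_right hJY hJY',
      map_add]
    module

lemma tensorialAt_nijenhuis_left (hJ : IsAlmostComplex I J) (Y : ∀ x : M, TangentSpace I x)
    (x : M) : TensorialAt I E (fun X => nijenhuis I J X Y x) x where
  smul {f X} hf hX := by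
    simp only [nijenhuis_swap J _ Y, (tensorialAt_nijenhuis_right hJ Y x).smul hf hX, smul_neg]
  add {X X'} hX hX' := by
    simp only [nijenhuis_swap J _ Y, (tensorialAt_nijenhuis_right hJ Y x).add hX hX', neg_add]

/-- The Nijenhuis tensor depends only on the values of the vector fields at the point. -/
lemma nijenhuis_congr [FiniteDimensional ℝ E] (hJ : IsAlmostComplex I J)
    {X X' Y Y' : ∀ x : M, TangentSpace I x} {x : M}
    (hX : SmoothFieldAt I X x) (hX' : SmoothFieldAt I X' x)
    (hY : SmoothFieldAt I Y x) (hY' : SmoothFieldAt I Y' x)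
    (h : X x = X' x) (h' : Y x = Y' x) :
    nijenhuis I J X Y x = nijenhuis I J X' Y' x :=
  TensorialAt.pointwise₂ (Φ := fun X Y => nijenhuis I J X Y x)
    (fun _ _ => tensorialAt_nijenhuis_left hJ _ x)
    (fun _ _ => tensorialAt_nijenhuis_right hJ _ x) hX.mdifferentiableAt hX'.mdifferentiableAt
    hY.mdifferentiableAt hY'.mdifferentiableAt h h'

end Tensoriality

/-! ### Extension of local sections to global ones by bump functions. -/

section Extension

variable {E : Type*} [NormedAddCommGroup E] [NormedSpace ℝ E] [FiniteDimensional ℝ E]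
  {H : Type*} [TopologicalSpace H] {I : ModelWithCorners ℝ E H}
  {M : Type*} [TopologicalSpace M] [T2Space M] [ChartedSpace H M] [IsManifold I ∞ M]
  {F : Type*} [NormedAddCommGroup F] [NormedSpace ℝ F] {V : M → Type*}
  [TopologicalSpace (TotalSpace F V)] [∀ x, TopologicalSpace (V x)] [∀ x, AddCommGroup (V x)]
  [∀ x, Module ℝ (V x)] [FiberBundle F V] [VectorBundle ℝ F V]

/-- A section which is smooth on a neighbourhood of a point agrees near this point with a global
smooth section. -/
lemma exists_contMDiff_section_eventuallyEq {s : ∀ x : M, V x} {u : Set M} {x : M}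
    (hu : IsOpen u) (hx : x ∈ u)
    (hs : ContMDiffOn I (I.prod 𝓘(ℝ, F)) ∞ (fun y => TotalSpace.mk' F y (s y)) u) :
    ∃ s' : ∀ x : M, V x,
      ContMDiff I (I.prod 𝓘(ℝ, F)) ∞ (fun y => TotalSpace.mk' F y (s' y)) ∧
        ∀ᶠ y in 𝓝 x, s' y = s y := by
  obtain ⟨f, -, hf⟩ := (SmoothBumpFunction.nhds_basis_tsupport (I := I) x).mem_iff.1
    (hu.mem_nhds hx)
  refine ⟨(f : M → ℝ) • s, ContMDiffOn.smul_section_of_tsupport f.contMDiff.contMDiffOn hu hf hs, ?_⟩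
  filter_upwards [f.eventuallyEq_one] with y hy
  simp [hy]

end Extension

/-! ### Operations on smooth vector fields. -/

section SmoothFields

variable {E : Type*} [NormedAddCommGroup E] [NormedSpace ℝ E]
  {H : Type*} [TopologicalSpace H] {I : ModelWithCorners ℝ E H}
  {M : Type*} [TopologicalSpace M] [ChartedSpace H M] [IsManifold I ∞ M]
  {X Y : ∀ x : M, TangentSpace I x} {x : M}

lemma SmoothFieldAt.congr (hX : SmoothFieldAt I X x) (h : ∀ᶠ y in 𝓝 x, Y y = X y) :
    SmoothFieldAt I Y x := by
  refine ContMDiffAt.congr_of_eventuallyEq hX ?_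
  filter_upwards [h] with y hy
  rw [hy]

lemma SmoothFieldAt.add (hX : SmoothFieldAt I X x) (hY : SmoothFieldAt I Y x) :
    SmoothFieldAt I (X + Y) x :=
  ContMDiffAt.add_section hX hY

lemma SmoothFieldAt.neg (hX : SmoothFieldAt I X x) : SmoothFieldAt I (-X) x :=
  ContMDiffAt.neg_section hX

lemma SmoothFieldAt.smul {f : M → ℝ} (hf : ContMDiffAt I 𝓘(ℝ, ℝ) ∞ f x)
    (hX : SmoothFieldAt I X x) : SmoothFieldAt I (f • X) x :=
  ContMDiffAt.smul_section hf hX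

lemma SmoothFieldAt.zero (x : M) : SmoothFieldAt I (0 : ∀ x : M, TangentSpace I x) x :=
  contMDiff_zeroSection ℝ (fun x : M => TangentSpace I x) x

lemma SmoothFieldAt.mlieBracket [CompleteSpace E] (hX : SmoothFieldAt I X x)
    (hY : SmoothFieldAt I Y x) : SmoothFieldAt I (mlieBracket I X Y) x :=
  have : IsManifold I (minSmoothness ℝ 2) M := by
    rw [minSmoothness_of_isRCLikeNormedField]
    infer_instance
  have : IsManifold I (((⊤ : ℕ∞) : ℕ∞ω) + 1) M := inferInstanceAs (IsManifold I ∞ M)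
  ContMDiffAt.mlieBracket_vectorField (n := ⊤) (m := ⊤) hX hY (by simp)

lemma smoothFieldAt_extend (v : TangentSpace I x) :
    SmoothFieldAt I (FiberBundle.extend E v) x :=
  FiberBundle.contMDiffAt_extend I E v

/-- Every tangent vector is the value of a smooth vector field. -/
lemma exists_smoothField [FiniteDimensional ℝ E] [T2Space M] (v : TangentSpace I x) :
    ∃ X : ∀ x : M, TangentSpace I x, (∀ y, SmoothFieldAt I X y) ∧ X x = v := by
  obtain ⟨s, hs, hsv⟩ := FiberBundle.exists_contMDiffOn_extend (k := ∞) I E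
    (V := fun x : M => TangentSpace I x) v
  obtain ⟨X, hX, hXv⟩ := exists_contMDiff_section_eventuallyEq isOpen_interior
    (mem_interior_iff_mem_nhds.2 hs) (hsv.mono interior_subset)
  exact ⟨X, hX, hXv.self_of_nhds.trans (by simp)⟩

end SmoothFields

/-! ### Smoothness of covariant derivatives. -/

section Connections

variable {E : Type*} [NormedAddCommGroup E] [NormedSpace ℝ E]
  {M : Type*} [TopologicalSpace M] [ChartedSpace E M] [IsManifold 𝓘(ℝ, E) ∞ M]
  {D : Connection E M} {X Y Z : ∀ x : M, TangentSpace 𝓘(ℝ, E) x} {x : M}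

lemma Connection.congr_of_mdifferentiableAt
    (hX : MDifferentiableAt 𝓘(ℝ, E) 𝓘(ℝ, E).tangent
      (fun y => (⟨y, X y⟩ : TangentBundle 𝓘(ℝ, E) M)) x)
    (hY : MDifferentiableAt 𝓘(ℝ, E) 𝓘(ℝ, E).tangent
      (fun y => (⟨y, Y y⟩ : TangentBundle 𝓘(ℝ, E) M)) x)
    (h : ∀ᶠ y in 𝓝 x, Y y = X y) : D Y x = D X x :=
  D.isCovariantDerivativeOn.congr_of_eventuallyEq (s := Set.univ) hY hX Filter.univ_mem h

variable [FiniteDimensional ℝ E] [T2Space M]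

/-- The covariant derivative of a smooth vector field along a smooth vector field is smooth. -/
lemma SmoothFieldAt.connection (hD : CovariantDerivative.ContMDiffCovariantDerivative D ∞)
    (hX : SmoothFieldAt 𝓘(ℝ, E) X x)
    (hZ : SmoothFieldAt 𝓘(ℝ, E) Z x) :
    SmoothFieldAt 𝓘(ℝ, E) (fun y => D Z y (X y)) x := by
  let t := trivializationAt E (fun x : M => TangentSpace 𝓘(ℝ, E) x) x
  have hx : x ∈ t.baseSet := FiberBundle.mem_baseSet_trivializationAt' x
  let b := Module.finBasis ℝ E
  -- The hypothesis `hD` is applied to globally smooth fields, whereas `Z` is only smooth near `x`.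
  -- So `Z` is expanded in a local frame whose members are replaced by global fields agreeing with
  -- them near `x`; the Leibniz rule then handles the coefficients.
  have hglob : ∀ i, ∃ s : ∀ x : M, TangentSpace 𝓘(ℝ, E) x, (∀ y, SmoothFieldAt 𝓘(ℝ, E) s y) ∧
      ∀ᶠ y in 𝓝 x, s y = t.localFrame b i y := fun i =>
    exists_contMDiff_section_eventuallyEq t.open_baseSet hx
      (t.contMDiffOn_localFrame_baseSet ∞ b i)
  choose s hs hst using hglob
  let c : Fin (Module.finrank ℝ E) → M → ℝ := fun i y => t.localFrameCoeff 𝓘(ℝ, E) b i y (Z y)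
  have hc : ∀ i, ContMDiffAt 𝓘(ℝ, E) 𝓘(ℝ, ℝ) ∞ (c i) x := fun i =>
    contMDiffAt_localFrameCoeff b hx hZ i
  -- Smoothness of `W` itself is carried along, since additivity of `D` needs differentiable
  -- summands at every point near `x`.
  let P : (∀ x : M, TangentSpace 𝓘(ℝ, E) x) → Prop := fun W =>
    SmoothFieldAt 𝓘(ℝ, E) W x ∧ SmoothFieldAt 𝓘(ℝ, E) (fun y => D W y (X y)) x
  have hP : ∀ S : Finset (Fin (Module.finrank ℝ E)), P (∑ i ∈ S, c i • s i) := by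
    intro S
    induction S using Finset.induction_on with
    | empty =>
      refine ⟨by simpa using SmoothFieldAt.zero x, ?_⟩
      simp only [Finset.sum_empty, D.zero]
      exact SmoothFieldAt.zero x
    | insert i S hi ih =>
      rw [Finset.sum_insert hi]
      have h1 := SmoothFieldAt.smul (hc i) (hs i x)
      refine ⟨h1.add ih.1, ?_⟩
      have h2 : SmoothFieldAt 𝓘(ℝ, E) (fun y => D (s i) y (X y)) x :=
        ContMDiffAt.clm_bundle_apply (E₁ := fun x : M => TangentSpace 𝓘(ℝ, E) x)
          (E₂ := fun x : M => TangentSpace 𝓘(ℝ, E) x)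
          ((hD.contMDiff.contMDiff (σ := s i)
            (fun y _ => (hs i y).contMDiffWithinAt)).contMDiffAt Filter.univ_mem) hX
      refine (((h2.smul (hc i)).add ((hs i x).smul (contMDiffAt_mvfderiv (hc i) hX))).add
        ih.2).congr ?_
      have hci : ∀ᶠ y in 𝓝 x, MDifferentiableAt 𝓘(ℝ, E) 𝓘(ℝ, ℝ) (c i) y := by
        filter_upwards [(contMDiffAt_iff_contMDiffAt_nhds (by simp)).1
          ((hc i).of_le (m := 1) (by simp))] with y hy
        exact hy.mdifferentiableAt (by simp)
      filter_upwards [h1.eventually, ih.1.eventually, hci] with y hy1 hy2 hy3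
      rw [D.isCovariantDerivativeOn.add hy1 hy2,
        D.isCovariantDerivativeOn.leibniz (hs i y).mdifferentiableAt hy3]
      rfl
  have hZe : ∀ᶠ y in 𝓝 x, Z y = (∑ i, c i • s i) y := by
    filter_upwards [t.eventually_eq_localFrame_sum_coeff_smul (I := 𝓘(ℝ, E)) b (s := Z) hx,
      Filter.eventually_all.2 hst] with y hy hsy
    rw [hy, Finset.sum_apply]
    exact Finset.sum_congr rfl fun i _ => by rw [Pi.smul_apply', hsy i]
  refine (hP Finset.univ).2.congr ?_
  filter_upwards [hZ.eventually, (hP Finset.univ).1.eventually,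
    eventually_eventually_nhds.2 hZe] with y hy hy' hye
  rw [Connection.congr_of_mdifferentiableAt hy' hy hye]

end Connections

/-! ### Functions and vector fields on the cotangent bundle. -/

section CotangentFields

variable {E : Type*} [NormedAddCommGroup E] [NormedSpace ℝ E]
  {M : Type*} [TopologicalSpace M] [ChartedSpace E M] [IsManifold 𝓘(ℝ, E) ∞ M]
  {X Y Z : ∀ x : M, TangentSpace 𝓘(ℝ, E) x} {γ : Cotangent E M}

/-- The `1`-form `α` is smooth at (that is, near) the point `x`. -/
def SmoothFormAt (α : ∀ x : M, TangentSpace 𝓘(ℝ, E) x →L[ℝ] ℝ) (x : M) : Prop :=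
  ContMDiffAt 𝓘(ℝ, E) (cotangentModel E) ∞ (fun y => (⟨y, α y⟩ : Cotangent E M)) x

lemma SmoothFormAt.contMDiffAt_apply {α : ∀ x : M, TangentSpace 𝓘(ℝ, E) x →L[ℝ] ℝ} {x : M}
    (hα : SmoothFormAt α x) (hX : SmoothFieldAt 𝓘(ℝ, E) X x) :
    ContMDiffAt 𝓘(ℝ, E) 𝓘(ℝ, ℝ) ∞ (fun y => α y (X y)) x := by
  have h : ContMDiffAt 𝓘(ℝ, E) (𝓘(ℝ, E).prod 𝓘(ℝ, ℝ)) ∞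
      (fun y => TotalSpace.mk' ℝ (E := Bundle.Trivial M ℝ) y (α y (X y))) x :=
    ContMDiffAt.clm_bundle_apply (F₁ := E) (E₁ := fun x : M => TangentSpace 𝓘(ℝ, E) x) hα hX
  exact (contMDiffAt_totalSpace.1 h).2

lemma contMDiffAt_proj_cotangent (γ : Cotangent E M) :
    ContMDiffAt (cotangentModel E) 𝓘(ℝ, E) ∞ (TotalSpace.proj : Cotangent E M → M) γ :=
  contMDiff_proj _ _

/-- The pairing of the tautological covector with a smooth field along the projection. -/
lemma contMDiffAt_pairing {A : ∀ α : Cotangent E M, TangentSpace 𝓘(ℝ, E) α.1}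
    (hA : ContMDiffAt (cotangentModel E) 𝓘(ℝ, E).tangent ∞
      (fun α => (⟨α.1, A α⟩ : TangentBundle 𝓘(ℝ, E) M)) γ) :
    ContMDiffAt (cotangentModel E) 𝓘(ℝ, ℝ) ∞ (fun α : Cotangent E M => α.2 (A α)) γ := by
  have h : ContMDiffAt (cotangentModel E) (𝓘(ℝ, E).prod 𝓘(ℝ, ℝ)) ∞
      (fun α : Cotangent E M => TotalSpace.mk' ℝ (E := Bundle.Trivial M ℝ) α.1 (α.2 (A α))) γ :=
    -- As a section along the projection, the tautological covector is the identity map of `T*M`.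
    ContMDiffAt.clm_bundle_apply (F₁ := E) (E₁ := fun x : M => TangentSpace 𝓘(ℝ, E) x)
      (F₂ := ℝ) (E₂ := Bundle.Trivial M ℝ) (b := fun α : Cotangent E M => α.1)
      (ϕ := fun α => α.2) contMDiffAt_id hA
  exact (contMDiffAt_totalSpace.1 h).2

lemma contMDiffAt_evalField (hY : SmoothFieldAt 𝓘(ℝ, E) Y γ.1) :
    ContMDiffAt (cotangentModel E) 𝓘(ℝ, ℝ) ∞ (evalField Y) γ :=
  contMDiffAt_pairing (ContMDiffAt.comp γ hY (contMDiffAt_proj_cotangent γ))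

lemma SmoothFieldAt.eventually_proj (hY : SmoothFieldAt 𝓘(ℝ, E) Y γ.1) :
    ∀ᶠ α : Cotangent E M in 𝓝 γ, MDifferentiableAt 𝓘(ℝ, E) 𝓘(ℝ, E).tangent
      (fun y => (⟨y, Y y⟩ : TangentBundle 𝓘(ℝ, E) M)) α.1 :=
  (contMDiffAt_proj_cotangent γ).continuousAt.eventually hY.eventually

/-- On functions pulled back from the base, tangent vectors of `T*M` act through `dπ`. -/
lemma mvfderiv_comp_proj {F : Type*} [NormedAddCommGroup F] [NormedSpace ℝ F] {f : M → F}
    (hf : MDifferentiableAt 𝓘(ℝ, E) 𝓘(ℝ, F) f γ.1) (w : TangentSpace (cotangentModel E) γ) :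
    mvfderiv (cotangentModel E) (fun α : Cotangent E M => f α.1) γ w =
      mvfderiv 𝓘(ℝ, E) f γ.1 (dproj γ w) := by
  have h := mfderiv_comp (I'' := 𝓘(ℝ, F)) γ hf
    ((contMDiffAt_proj_cotangent γ).mdifferentiableAt (by simp))
  exact congrArg (fun A => A w) h

lemma contMDiffAt_apply_proj {α : ∀ x : M, TangentSpace 𝓘(ℝ, E) x →L[ℝ] ℝ}
    (hα : SmoothFormAt α γ.1) (hZ : SmoothFieldAt 𝓘(ℝ, E) Z γ.1) :
    ContMDiffAt (cotangentModel E) 𝓘(ℝ, ℝ) ∞ (fun η : Cotangent E M => α η.1 (Z η.1)) γ :=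
  (hα.contMDiffAt_apply hZ).comp γ (contMDiffAt_proj_cotangent γ)

variable [FiniteDimensional ℝ E]

/-- A vector field on `T*M` is smooth if its projection is smooth and if it maps the functions
`α ↦ α(Y)` to smooth functions. -/
lemma smoothFieldAt_cotangent {V : ∀ α : Cotangent E M, TangentSpace (cotangentModel E) α}
    (h1 : ContMDiffAt (cotangentModel E) 𝓘(ℝ, E).tangent ∞
      (fun α => (⟨α.1, dproj α (V α)⟩ : TangentBundle 𝓘(ℝ, E) M)) γ)
    (h2 : ∀ Y : ∀ x : M, TangentSpace 𝓘(ℝ, E) x, SmoothFieldAt 𝓘(ℝ, E) Y γ.1 →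
      ContMDiffAt (cotangentModel E) 𝓘(ℝ, ℝ) ∞
        (fun α => mvfderiv (cotangentModel E) (evalField Y) α (V α)) γ) :
    SmoothFieldAt (cotangentModel E) V γ := by
  rw [smoothFieldAt_iff]
  set c : Cotangent E M → E × (E →L[ℝ] ℝ) := fun α => extChartAt (cotangentModel E) γ α with hc
  have hcd : ∀ᶠ α in 𝓝 γ, MDifferentiableAt (cotangentModel E) 𝓘(ℝ, E × (E →L[ℝ] ℝ)) c α := by
    filter_upwards [(chartAt (ModelProd E (E →L[ℝ] ℝ)) γ).open_source.mem_nhds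
      (mem_chart_source _ γ)] with α hα
    exact mdifferentiableAt_extChartAt hα
  have hfst : ContMDiffAt (cotangentModel E) 𝓘(ℝ, E) ∞
      (fun α => (mvfderiv (cotangentModel E) c α (V α)).1) γ := by
    have h3 := (contMDiffAt_totalSpace.1 h1).2
    refine h3.congr_of_eventuallyEq ?_
    have hU : ∀ᶠ α : Cotangent E M in 𝓝 γ, α.1 ∈ (chartAt E γ.1).source :=
      (contMDiffAt_proj_cotangent γ).continuousAt.eventually
        ((chartAt E γ.1).open_source.mem_nhds (mem_chart_source E γ.1))
    filter_upwards [hcd, hU] with α hα hαU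
    have h5 := mvfderiv_clm_comp hα (ContinuousLinearMap.fst ℝ E (E →L[ℝ] ℝ)) (V α)
    have h6 : mvfderiv (cotangentModel E) (ContinuousLinearMap.fst ℝ E (E →L[ℝ] ℝ) ∘ c) α (V α) =
        mvfderiv 𝓘(ℝ, E) (extChartAt 𝓘(ℝ, E) γ.1) α.1 (dproj α (V α)) :=
      mvfderiv_comp_proj (mdifferentiableAt_extChartAt hαU) _
    refine h5.symm.trans (h6.trans ?_)
    have h := TangentBundle.continuousLinearMapAt_trivializationAt (I := 𝓘(ℝ, E)) hαU
    have h2 : (trivializationAt E (TangentSpace 𝓘(ℝ, E)) γ.1 ⟨α.1, dproj α (V α)⟩).2 =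
        (trivializationAt E (TangentSpace 𝓘(ℝ, E)) γ.1).continuousLinearMapAt ℝ α.1
          (dproj α (V α)) := by
      rw [Trivialization.continuousLinearMapAt_apply, Trivialization.linearMapAt_apply,
        if_pos (by simpa using hαU)]
    rw [h2, h]
    rfl
  have hsnd : ContMDiffAt (cotangentModel E) 𝓘(ℝ, E →L[ℝ] ℝ) ∞
      (fun α => (mvfderiv (cotangentModel E) c α (V α)).2) γ := by
    refine contMDiffAt_clm_of_apply fun e => ?_
    have hx := FiberBundle.mem_baseSet_trivializationAt' (F := E)
      (E := fun x : M => TangentSpace 𝓘(ℝ, E) x) γ.1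
    set t := trivializationAt E (fun x : M => TangentSpace 𝓘(ℝ, E) x) γ.1 with ht
    let A : E × (E →L[ℝ] ℝ) →L[ℝ] ℝ :=
      (ContinuousLinearMap.apply ℝ ℝ e).comp (ContinuousLinearMap.snd ℝ E (E →L[ℝ] ℝ))
    -- The fibre coordinate in the direction `e` is, near `γ`, the function `α ↦ α(Y)` for the field
    -- `Y` with constant coordinates `e`; this is why such functions suffice as tests.
    have e7 : ∀ᶠ α in 𝓝 γ, (A ∘ c) α = evalField (E := E) (FiberBundle.extend E (t.symm γ.1 e)) α := by
      have hU : (TotalSpace.proj : Cotangent E M → M) ⁻¹' t.baseSet ∈ 𝓝 γ :=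
        (contMDiffAt_proj_cotangent γ).continuousAt.preimage_mem_nhds (t.open_baseSet.mem_nhds hx)
      filter_upwards [hU] with α hα
      have h8 : (A ∘ c) α = α.2 (t.symmL ℝ α.1 e) := by
        have h11 : (A ∘ c) α = (trivializationAt ℝ (Bundle.Trivial M ℝ) γ.1).continuousLinearMapAt
          ℝ α.1 (α.2 (t.symmL ℝ α.1 e)) := rfl
        rw [h11]
        simp
      rw [h8, t.symmL_apply hα]
      simp [evalField, FiberBundle.extend, ← ht, t.apply_mk_symm hx]
    refine (h2 (FiberBundle.extend E (t.symm γ.1 e))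
      (smoothFieldAt_extend _)).congr_of_eventuallyEq ?_
    filter_upwards [hcd, eventually_eventually_nhds.2 e7] with α hα hα7
    have h9 := mvfderiv_clm_comp hα A (V α)
    rw [mvfderiv, Filter.EventuallyEq.mfderiv_eq hα7] at h9
    exact h9.symm
  exact (hfst.prodMk_space hsnd)

end CotangentFields

/-! ### Lifts of fields and forms to the cotangent bundle, and their brackets. -/

section Lifts

lemma mvfderiv_congr {E : Type*} [NormedAddCommGroup E] [NormedSpace ℝ E]
    {H : Type*} [TopologicalSpace H] {I : ModelWithCorners ℝ E H}
    {M : Type*} [TopologicalSpace M] [ChartedSpace H M]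
    {F : Type*} [NormedAddCommGroup F] [NormedSpace ℝ F] {f g : M → F} {x : M}
    (h : f =ᶠ[𝓝 x] g) (w : TangentSpace I x) : mvfderiv I f x w = mvfderiv I g x w := by
  rw [mvfderiv, h.mfderiv_eq]
  rfl

variable {E : Type*} [NormedAddCommGroup E] [NormedSpace ℝ E] [FiniteDimensional ℝ E]
  {M : Type*} [TopologicalSpace M] [ChartedSpace E M] [IsManifold 𝓘(ℝ, E) ∞ M]
  {D : Connection E M} {X Y Z : ∀ x : M, TangentSpace 𝓘(ℝ, E) x}
  {α β : ∀ x : M, TangentSpace 𝓘(ℝ, E) x →L[ℝ] ℝ} {γ : Cotangent E M}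
  {J : ∀ x : M, TangentSpace 𝓘(ℝ, E) x →L[ℝ] TangentSpace 𝓘(ℝ, E) x}

/-- The vector field on `T*M` which is the sum of the horizontal lift of `X` and of the vertical
lift of `α`. -/
noncomputable def lift (D : Connection E M) (X : ∀ x : M, TangentSpace 𝓘(ℝ, E) x)
    (α : ∀ x : M, TangentSpace 𝓘(ℝ, E) x →L[ℝ] ℝ) (γ : Cotangent E M) :
    TangentSpace (cotangentModel E) γ :=
  (splitting D γ).symm (X γ.1, α γ.1)

lemma splitting_lift (D : Connection E M) (X : ∀ x : M, TangentSpace 𝓘(ℝ, E) x)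
    (α : ∀ x : M, TangentSpace 𝓘(ℝ, E) x →L[ℝ] ℝ) (γ : Cotangent E M) :
    splitting D γ (lift D X α γ) = (X γ.1, α γ.1) :=
  (splitting D γ).apply_symm_apply _

@[simp]
lemma dproj_lift (D : Connection E M) (X : ∀ x : M, TangentSpace 𝓘(ℝ, E) x)
    (α : ∀ x : M, TangentSpace 𝓘(ℝ, E) x →L[ℝ] ℝ) (γ : Cotangent E M) :
    dproj γ (lift D X α γ) = X γ.1 :=
  congrArg Prod.fst (splitting_lift D X α γ)

@[simp]
lemma verticalPart_lift (D : Connection E M) (X : ∀ x : M, TangentSpace 𝓘(ℝ, E) x)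
    (α : ∀ x : M, TangentSpace 𝓘(ℝ, E) x →L[ℝ] ℝ) (γ : Cotangent E M) :
    verticalPart D γ (lift D X α γ) = α γ.1 :=
  congrArg Prod.snd (splitting_lift D X α γ)

lemma cotangent_ext {w w' : TangentSpace (cotangentModel E) γ} (h : dproj γ w = dproj γ w')
    (h' : verticalPart D γ w = verticalPart D γ w') : w = w' :=
  splittingMap_injective D γ (Prod.ext h h')

/-- By tensoriality the vertical part may be computed with any differentiable field of the given
value, not just the chosen extension. -/
lemma verticalPart_apply (hZ : MDifferentiableAt 𝓘(ℝ, E) 𝓘(ℝ, E).tangent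
      (fun y => (⟨y, Z y⟩ : TangentBundle 𝓘(ℝ, E) M)) γ.1)
    (w : TangentSpace (cotangentModel E) γ) :
    verticalPart D γ w (Z γ.1) =
      mvfderiv (cotangentModel E) (evalField Z) γ w - γ.2 (D Z γ.1 (dproj γ w)) :=
  TensorialAt.mkHom_apply (tensorialAt_verticalPartAux D γ w) hZ

lemma mvfderiv_evalField (hZ : MDifferentiableAt 𝓘(ℝ, E) 𝓘(ℝ, E).tangent
      (fun y => (⟨y, Z y⟩ : TangentBundle 𝓘(ℝ, E) M)) γ.1)
    (w : TangentSpace (cotangentModel E) γ) :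
    mvfderiv (cotangentModel E) (evalField Z) γ w =
      γ.2 (D Z γ.1 (dproj γ w)) + verticalPart D γ w (Z γ.1) := by
  rw [verticalPart_apply hZ]
  ring

lemma mvfderiv_evalField_lift (hZ : MDifferentiableAt 𝓘(ℝ, E) 𝓘(ℝ, E).tangent
      (fun y => (⟨y, Z y⟩ : TangentBundle 𝓘(ℝ, E) M)) γ.1) :
    mvfderiv (cotangentModel E) (evalField Z) γ (lift D X α γ) =
      γ.2 (D Z γ.1 (X γ.1)) + α γ.1 (Z γ.1) := by
  rw [mvfderiv_evalField (D := D) hZ, dproj_lift, verticalPart_lift]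

section Induced

variable (D J) (ε : ℝ) (γ)

@[simp]
lemma dproj_inducedStructure (w : TangentSpace (cotangentModel E) γ) :
    dproj γ (inducedStructure D (diagonalStructure ε J) γ w) = J γ.1 (dproj γ w) :=
  congrArg Prod.fst ((splitting D γ).apply_symm_apply (diagonalStructure ε J γ.1 (splitting D γ w)))

@[simp]
lemma verticalPart_inducedStructure (w : TangentSpace (cotangentModel E) γ)
    (z : TangentSpace 𝓘(ℝ, E) γ.1) :
    verticalPart D γ (inducedStructure D (diagonalStructure ε J) γ w) z =
      ε * verticalPart D γ w (J γ.1 z) := by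
  have h : verticalPart D γ (inducedStructure D (diagonalStructure ε J) γ w) =
      (verticalPart D γ w).comp (ε • J γ.1) :=
    congrArg Prod.snd
      ((splitting D γ).apply_symm_apply (diagonalStructure ε J γ.1 (splitting D γ w)))
  rw [h]
  simp

/-- Since lifts are stable under the induced structure, every bracket in its Nijenhuis tensor on
lifts is again a bracket of lifts. -/
lemma inducedStructure_lift (X : ∀ x : M, TangentSpace 𝓘(ℝ, E) x)
    (α : ∀ x : M, TangentSpace 𝓘(ℝ, E) x →L[ℝ] ℝ) :
    inducedStructure D (diagonalStructure ε J) γ (lift D X α γ) =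
      lift D (fun x => J x (X x)) (fun x => ε • (α x).comp (J x)) γ := by
  refine cotangent_ext (D := D) (by simp) ?_
  ext z
  simp

end Induced

variable [T2Space M]

/-- A lift sends the function `γ ↦ γ(Z)` to `γ ↦ γ(D_X Z) + α(Z)`, which is smooth. -/
lemma smoothFieldAt_lift (hD : CovariantDerivative.ContMDiffCovariantDerivative D ∞)
    (hX : SmoothFieldAt 𝓘(ℝ, E) X γ.1) (hα : SmoothFormAt α γ.1) :
    SmoothFieldAt (cotangentModel E) (lift D X α) γ := by
  refine smoothFieldAt_cotangent ?_ fun Z hZ => ?_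
  · simp only [dproj_lift]
    exact ContMDiffAt.comp γ hX (contMDiffAt_proj_cotangent γ)
  · refine ((contMDiffAt_evalField (hX.connection hD hZ)).add
      (contMDiffAt_apply_proj hα hZ)).congr_of_eventuallyEq ?_
    filter_upwards [hZ.eventually_proj] with η hη
    rw [mvfderiv_evalField_lift hη]
    rfl

/-- Lifts are `π`-related to the fields they lift, hence so are the brackets. The proof tests both
sides on the chart at `π(γ)`, whose derivative there is the identity. -/
lemma dproj_mlieBracket_lift (hD : CovariantDerivative.ContMDiffCovariantDerivative D ∞)
    (hX : SmoothFieldAt 𝓘(ℝ, E) X γ.1) (hα : SmoothFormAt α γ.1)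
    (hY : SmoothFieldAt 𝓘(ℝ, E) Y γ.1) (hβ : SmoothFormAt β γ.1) :
    dproj γ (mlieBracket (cotangentModel E) (lift D X α) (lift D Y β) γ) =
      mlieBracket 𝓘(ℝ, E) X Y γ.1 := by
  have : CompleteSpace E := FiniteDimensional.complete ℝ E
  let f : M → E := fun y => extChartAt 𝓘(ℝ, E) γ.1 y
  have hfs : ContMDiffAt 𝓘(ℝ, E) 𝓘(ℝ, E) ∞ f γ.1 := contMDiffAt_extChartAt
  have hid : ∀ v : TangentSpace 𝓘(ℝ, E) γ.1, mvfderiv 𝓘(ℝ, E) f γ.1 v = v := fun v =>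
    congrArg (fun A : TangentSpace 𝓘(ℝ, E) γ.1 →L[ℝ] TangentSpace 𝓘(ℝ, E) γ.1 => A v)
      mfderiv_extChartAt_self
  have hfd : ∀ᶠ η : Cotangent E M in 𝓝 γ, MDifferentiableAt 𝓘(ℝ, E) 𝓘(ℝ, E) f η.1 := by
    filter_upwards [(contMDiffAt_proj_cotangent γ).continuousAt.eventually
      ((chartAt E γ.1).open_source.mem_nhds (mem_chart_source E γ.1))] with η hη
    exact mdifferentiableAt_extChartAt hη
  have key : ∀ {U W : ∀ x : M, TangentSpace 𝓘(ℝ, E) x}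
      {a b : ∀ x : M, TangentSpace 𝓘(ℝ, E) x →L[ℝ] ℝ}, SmoothFieldAt 𝓘(ℝ, E) W γ.1 →
      mvfderiv (cotangentModel E) (fun η => mvfderiv (cotangentModel E)
        (fun η : Cotangent E M => f η.1) η (lift D W b η)) γ (lift D U a γ) =
      mvfderiv 𝓘(ℝ, E) (fun y => mvfderiv 𝓘(ℝ, E) f y (W y)) γ.1 (U γ.1) := by
    intro U W a b hW
    have h1 : (fun η => mvfderiv (cotangentModel E)
        (fun η : Cotangent E M => f η.1) η (lift D W b η)) =ᶠ[𝓝 γ]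
        fun η : Cotangent E M => mvfderiv 𝓘(ℝ, E) f η.1 (W η.1) := by
      filter_upwards [hfd] with η hη
      rw [mvfderiv_comp_proj hη, dproj_lift]
    rw [mvfderiv_congr h1,
      mvfderiv_comp_proj (f := fun y => mvfderiv 𝓘(ℝ, E) f y (W y))
        ((contMDiffAt_mvfderiv hfs hW).mdifferentiableAt (by simp)), dproj_lift]
  have h2 := mvfderiv_mlieBracket (I := cotangentModel E)
    (f := fun η : Cotangent E M => f η.1) (x := γ)
    ((hfs.comp γ (contMDiffAt_proj_cotangent γ)).of_le ENat.LEInfty.out)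
    (smoothFieldAt_lift hD hX hα).mdifferentiableAt
    (smoothFieldAt_lift hD hY hβ).mdifferentiableAt
  rw [key hY, key hX, mvfderiv_comp_proj (hfs.mdifferentiableAt (by simp)),
    ← mvfderiv_mlieBracket (hfs.of_le ENat.LEInfty.out) hX.mdifferentiableAt
      hY.mdifferentiableAt, hid, hid] at h2
  exact h2

/-- The vertical part of the Lie bracket of two lifts. -/
lemma verticalPart_mlieBracket_lift (hD : CovariantDerivative.ContMDiffCovariantDerivative D ∞)
    (hX : SmoothFieldAt 𝓘(ℝ, E) X γ.1) (hα : SmoothFormAt α γ.1)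
    (hY : SmoothFieldAt 𝓘(ℝ, E) Y γ.1) (hβ : SmoothFormAt β γ.1)
    (hZ : SmoothFieldAt 𝓘(ℝ, E) Z γ.1) :
    verticalPart D γ (mlieBracket (cotangentModel E) (lift D X α) (lift D Y β) γ) (Z γ.1) =
      -γ.2 (curvature D X Y Z γ.1)
        + (mvfderiv 𝓘(ℝ, E) (fun y => β y (Z y)) γ.1 (X γ.1) - β γ.1 (D Z γ.1 (X γ.1)))
        - (mvfderiv 𝓘(ℝ, E) (fun y => α y (Z y)) γ.1 (Y γ.1) - α γ.1 (D Z γ.1 (Y γ.1))) := by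
  have : CompleteSpace E := FiniteDimensional.complete ℝ E
  have key : ∀ {U W : ∀ x : M, TangentSpace 𝓘(ℝ, E) x}
      {a b : ∀ x : M, TangentSpace 𝓘(ℝ, E) x →L[ℝ] ℝ}, SmoothFieldAt 𝓘(ℝ, E) W γ.1 →
      SmoothFormAt b γ.1 →
      mvfderiv (cotangentModel E) (fun η => mvfderiv (cotangentModel E)
        (evalField Z) η (lift D W b η)) γ (lift D U a γ) =
      γ.2 (D (fun y => D Z y (W y)) γ.1 (U γ.1)) + a γ.1 (D Z γ.1 (W γ.1))
        + mvfderiv 𝓘(ℝ, E) (fun y => b y (Z y)) γ.1 (U γ.1) := by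
    intro U W a b hW hb
    have hWZ := hW.connection hD hZ
    have h1 : (fun η => mvfderiv (cotangentModel E) (evalField Z) η (lift D W b η)) =ᶠ[𝓝 γ]
        evalField (fun y => D Z y (W y)) + fun η : Cotangent E M => b η.1 (Z η.1) := by
      filter_upwards [hZ.eventually_proj] with η hη
      rw [mvfderiv_evalField_lift hη]
      rfl
    have hbZ := hb.contMDiffAt_apply hZ
    rw [mvfderiv_congr h1, mvfderiv_add (mdifferentiableAt_evalField hWZ.mdifferentiableAt)
      ((contMDiffAt_apply_proj hb hZ).mdifferentiableAt (by simp)), add_apply,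
      mvfderiv_evalField_lift hWZ.mdifferentiableAt,
      mvfderiv_comp_proj (f := fun y => b y (Z y)) (hbZ.mdifferentiableAt (by simp)), dproj_lift]
  -- The commutator of the lifts contributes `γ(D_X D_Y Z - D_Y D_X Z)`; the vertical part subtracts
  -- `γ(D_{[X,Y]} Z)`, and together they give `-γ(R(X,Y)Z)`.
  rw [verticalPart_apply hZ.mdifferentiableAt, mvfderiv_mlieBracket (I := cotangentModel E)
    ((contMDiffAt_evalField hZ).of_le (m := 2) ENat.LEInfty.out)
    (smoothFieldAt_lift hD hX hα).mdifferentiableAt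
    (smoothFieldAt_lift hD hY hβ).mdifferentiableAt, key hY hβ, key hX hα,
    dproj_mlieBracket_lift hD hX hα hY hβ]
  simp only [curvature, map_add, map_neg]
  ring

end Lifts

/-! ### The Nijenhuis tensor of the induced structures and the integrability criterion. -/

section Integrability

variable {E : Type*} [NormedAddCommGroup E] [NormedSpace ℝ E]
  {M : Type*} [TopologicalSpace M] [ChartedSpace E M] {x : M}

lemma mvfderiv_const_mul {f : M → ℝ} (hf : MDifferentiableAt 𝓘(ℝ, E) 𝓘(ℝ, ℝ) f x) (c : ℝ)
    (v : TangentSpace 𝓘(ℝ, E) x) :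
    mvfderiv 𝓘(ℝ, E) (fun y => c * f y) x v = c * mvfderiv 𝓘(ℝ, E) f x v :=
  mvfderiv_clm_comp hf (ContinuousLinearMap.lsmul ℝ ℝ c) v

lemma eq_zero_of_forall_covector {v : TangentSpace 𝓘(ℝ, E) x}
    (h : ∀ ξ : TangentSpace 𝓘(ℝ, E) x →L[ℝ] ℝ, ξ v = 0) : v = 0 :=
  SeparatingDual.eq_zero_of_forall_dual_eq_zero (V := E) (R := ℝ) h

variable [IsManifold 𝓘(ℝ, E) ∞ M]

lemma smoothFormAt_extend (ξ : TangentSpace 𝓘(ℝ, E) x →L[ℝ] ℝ) :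
    SmoothFormAt (FiberBundle.extend (E := fun x : M => TangentSpace 𝓘(ℝ, E) x →L[ℝ] ℝ)
      (E →L[ℝ] ℝ) ξ) x :=
  FiberBundle.contMDiffAt_extend (V := fun x : M => TangentSpace 𝓘(ℝ, E) x →L[ℝ] ℝ) 𝓘(ℝ, E)
    (E →L[ℝ] ℝ) ξ

lemma covector_extend_self (ξ : TangentSpace 𝓘(ℝ, E) x →L[ℝ] ℝ) :
    FiberBundle.extend (E := fun x : M => TangentSpace 𝓘(ℝ, E) x →L[ℝ] ℝ) (E →L[ℝ] ℝ) ξ x = ξ :=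
  FiberBundle.extend_apply_self (E := fun x : M => TangentSpace 𝓘(ℝ, E) x →L[ℝ] ℝ) (E →L[ℝ] ℝ) ξ

variable [FiniteDimensional ℝ E]
  {D : Connection E M} {X Y Z : ∀ x : M, TangentSpace 𝓘(ℝ, E) x}
  {α β : ∀ x : M, TangentSpace 𝓘(ℝ, E) x →L[ℝ] ℝ} {γ : Cotangent E M}
  {J : ∀ x : M, TangentSpace 𝓘(ℝ, E) x →L[ℝ] TangentSpace 𝓘(ℝ, E) x} {ε : ℝ}

lemma SmoothFormAt.smul_comp (hJ : IsAlmostComplex 𝓘(ℝ, E) J) (ε : ℝ) (hα : SmoothFormAt α x) :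
    SmoothFormAt (fun x => ε • (α x).comp (J x)) x := by
  refine contMDiffAt_hom_of_extend (E₁ := fun x : M => TangentSpace 𝓘(ℝ, E) x)
    (E₂ := Bundle.Trivial M ℝ) (F₁ := E) (F₂ := ℝ) fun v => ?_
  refine contMDiffAt_totalSpace.2 ⟨contMDiffAt_id, ?_⟩
  exact contMDiffAt_const.mul
    (hα.contMDiffAt_apply (hJ.smoothFieldAt (smoothFieldAt_extend v)))

lemma verticalPart_nijenhuis (V W : ∀ γ : Cotangent E M, TangentSpace (cotangentModel E) γ)
    (z : TangentSpace 𝓘(ℝ, E) γ.1) :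
    verticalPart D γ (nijenhuis (cotangentModel E) (inducedStructure D (diagonalStructure ε J))
      V W γ) z =
      verticalPart D γ (mlieBracket (cotangentModel E)
        (fun η => inducedStructure D (diagonalStructure ε J) η (V η))
        (fun η => inducedStructure D (diagonalStructure ε J) η (W η)) γ) z
      - ε * verticalPart D γ (mlieBracket (cotangentModel E)
        (fun η => inducedStructure D (diagonalStructure ε J) η (V η)) W γ) (J γ.1 z)
      - ε * verticalPart D γ (mlieBracket (cotangentModel E) V
        (fun η => inducedStructure D (diagonalStructure ε J) η (W η)) γ) (J γ.1 z)
      - verticalPart D γ (mlieBracket (cotangentModel E) V W γ) z := by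
  rw [nijenhuis, LinearMap.map_sub, LinearMap.map_sub, LinearMap.map_sub, sub_apply, sub_apply,
    sub_apply, verticalPart_inducedStructure, verticalPart_inducedStructure]

variable [T2Space M]

lemma isAlmostComplex_inducedStructure
    (hD : CovariantDerivative.ContMDiffCovariantDerivative D ∞)
    (hJ : IsAlmostComplex 𝓘(ℝ, E) J) (hε : ε * ε = 1) :
    IsAlmostComplex (cotangentModel E) (inducedStructure D (diagonalStructure ε J)) where
  sq γ w := by
    refine cotangent_ext (D := D) (by
      rw [dproj_inducedStructure, dproj_inducedStructure, hJ.sq, ContinuousLinearMap.map_neg]) ?_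
    ext z
    rw [verticalPart_inducedStructure, verticalPart_inducedStructure, hJ.sq, LinearMap.map_neg,
      neg_apply, ContinuousLinearMap.map_neg, ← mul_assoc, hε, one_mul]
  smooth γ := by
    refine contMDiffAt_hom_of_extend (E₁ := fun α : Cotangent E M => TangentSpace (cotangentModel E) α)
      (E₂ := fun α : Cotangent E M => TangentSpace (cotangentModel E) α) fun v => ?_
    have hV := smoothFieldAt_extend (I := cotangentModel E) v
    set V := FiberBundle.extend (E := fun α : Cotangent E M => TangentSpace (cotangentModel E) α)
      (E × (E →L[ℝ] ℝ)) v
    have hπV : ContMDiffAt (cotangentModel E) 𝓘(ℝ, E).tangent ∞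
        (fun α => (⟨α.1, dproj α (V α)⟩ : TangentBundle 𝓘(ℝ, E) M)) γ :=
      ContMDiffAt.mfderiv_field (contMDiffAt_proj_cotangent γ) hV
    have hJπV : ContMDiffAt (cotangentModel E) 𝓘(ℝ, E).tangent ∞
        (fun α => (⟨α.1, J α.1 (dproj α (V α))⟩ : TangentBundle 𝓘(ℝ, E) M)) γ :=
      ContMDiffAt.clm_bundle_apply (E₁ := fun x : M => TangentSpace 𝓘(ℝ, E) x)
        (E₂ := fun x : M => TangentSpace 𝓘(ℝ, E) x)
        ((hJ.smooth γ.1).comp γ (contMDiffAt_proj_cotangent γ)) hπV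
    -- Here `A` is a field along the projection and not one on `M`, so `D Y` has to be smooth as a
    -- field of endomorphisms.
    have hDY : ∀ {Y : ∀ x : M, TangentSpace 𝓘(ℝ, E) x}
        {A : ∀ α : Cotangent E M, TangentSpace 𝓘(ℝ, E) α.1}, SmoothFieldAt 𝓘(ℝ, E) Y γ.1 →
        ContMDiffAt (cotangentModel E) 𝓘(ℝ, E).tangent ∞
          (fun α => (⟨α.1, A α⟩ : TangentBundle 𝓘(ℝ, E) M)) γ →
        ContMDiffAt (cotangentModel E) 𝓘(ℝ, ℝ) ∞
          (fun α : Cotangent E M => α.2 (D Y α.1 (A α))) γ := by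
      intro Y A hY hA
      have h : ContMDiffAt 𝓘(ℝ, E) (𝓘(ℝ, E).prod 𝓘(ℝ, E →L[ℝ] E)) ∞
          (fun x => TotalSpace.mk' (E →L[ℝ] E)
            (E := fun x : M => TangentSpace 𝓘(ℝ, E) x →L[ℝ] TangentSpace 𝓘(ℝ, E) x) x (D Y x))
          γ.1 :=
        contMDiffAt_hom_of_extend (E₁ := fun x : M => TangentSpace 𝓘(ℝ, E) x)
          (E₂ := fun x : M => TangentSpace 𝓘(ℝ, E) x)
          fun v => (smoothFieldAt_extend v).connection hD hY
      exact contMDiffAt_pairing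
        (ContMDiffAt.clm_bundle_apply (E₁ := fun x : M => TangentSpace 𝓘(ℝ, E) x)
          (E₂ := fun x : M => TangentSpace 𝓘(ℝ, E) x)
          (h.comp γ (contMDiffAt_proj_cotangent γ)) hA)
    refine smoothFieldAt_cotangent ?_ fun Y hY => ?_
    · simp only [dproj_inducedStructure]
      exact hJπV
    · have hJY := hJ.smoothFieldAt hY
      -- The derivative of `α ↦ α(Y)` along the image of `V` is `α(D_{J dπV} Y)` plus `ε` times the
      -- vertical part of `V` on `JY`; the latter is the derivative of `α ↦ α(JY)` along `V` minus
      -- `α(D_{dπV}(JY))`.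
      refine ((hDY hY hJπV).add ((contMDiffAt_const (c := ε)).mul
        ((contMDiffAt_mvfderiv (contMDiffAt_evalField hJY) hV).sub
          (hDY hJY hπV)))).congr_of_eventuallyEq ?_
      filter_upwards [hY.eventually_proj, hJY.eventually_proj] with η hη hη'
      rw [mvfderiv_evalField (D := D) hη, dproj_inducedStructure, verticalPart_inducedStructure,
        verticalPart_apply hη']
      rfl

/-- Both the brackets and the structure commute with `dπ` on lifts, so the forms, the connection and
`ε` leave no trace in the horizontal part. -/
lemma dproj_nijenhuis_lift (hD : CovariantDerivative.ContMDiffCovariantDerivative D ∞)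
    (hJ : IsAlmostComplex 𝓘(ℝ, E) J) (ε : ℝ)
    (hX : SmoothFieldAt 𝓘(ℝ, E) X γ.1) (hα : SmoothFormAt α γ.1)
    (hY : SmoothFieldAt 𝓘(ℝ, E) Y γ.1) (hβ : SmoothFormAt β γ.1) :
    dproj γ (nijenhuis (cotangentModel E) (inducedStructure D (diagonalStructure ε J))
      (lift D X α) (lift D Y β) γ) = nijenhuis 𝓘(ℝ, E) J X Y γ.1 := by
  have hJX := hJ.smoothFieldAt hX
  have hJY := hJ.smoothFieldAt hY
  have hJα := hα.smul_comp hJ ε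
  have hJβ := hβ.smul_comp hJ ε
  simp only [nijenhuis, inducedStructure_lift]
  rw [ContinuousLinearMap.map_sub, ContinuousLinearMap.map_sub, ContinuousLinearMap.map_sub,
    dproj_inducedStructure, dproj_inducedStructure]
  erw [dproj_mlieBracket_lift hD hJX hJα hJY hJβ, dproj_mlieBracket_lift hD hJX hJα hY hβ,
    dproj_mlieBracket_lift hD hX hα hJY hJβ, dproj_mlieBracket_lift hD hX hα hY hβ]

-- The central formula. The derivatives of the functions `β(Z)`, `β(JZ)`, `α(Z)`, `α(JZ)` cancel,
-- which leaves the curvature paired with `γ` and the derivative of `J` paired with the two forms.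
set_option maxHeartbeats 2000000 in
lemma verticalPart_nijenhuis_lift (hD : CovariantDerivative.ContMDiffCovariantDerivative D ∞)
    (hJ : IsAlmostComplex 𝓘(ℝ, E) J) (hε : ε * ε = 1)
    (hX : SmoothFieldAt 𝓘(ℝ, E) X γ.1) (hα : SmoothFormAt α γ.1)
    (hY : SmoothFieldAt 𝓘(ℝ, E) Y γ.1) (hβ : SmoothFormAt β γ.1)
    (hZ : SmoothFieldAt 𝓘(ℝ, E) Z γ.1) :
    verticalPart D γ (nijenhuis (cotangentModel E) (inducedStructure D (diagonalStructure ε J))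
      (lift D X α) (lift D Y β) γ) (Z γ.1) =
      γ.2 ((curvature D X Y Z γ.1
          - curvature D (fun y => J y (X y)) (fun y => J y (Y y)) Z γ.1)
        + ε • (curvature D (fun y => J y (X y)) Y (fun y => J y (Z y)) γ.1
          + curvature D X (fun y => J y (Y y)) (fun y => J y (Z y)) γ.1))
      + β γ.1 (ε • derivEnd D J (fun y => J y (X y)) Z γ.1 + J γ.1 (derivEnd D J X Z γ.1))
      - α γ.1 (ε • derivEnd D J (fun y => J y (Y y)) Z γ.1 + J γ.1 (derivEnd D J Y Z γ.1)) := by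
  have hJX := hJ.smoothFieldAt hX
  have hJY := hJ.smoothFieldAt hY
  have hJZ := hJ.smoothFieldAt hZ
  have hJα := hα.smul_comp hJ ε
  have hJβ := hβ.smul_comp hJ ε
  have hsmul : ∀ {δ : ∀ x : M, TangentSpace 𝓘(ℝ, E) x →L[ℝ] ℝ}
      {W : ∀ x : M, TangentSpace 𝓘(ℝ, E) x} (v : TangentSpace 𝓘(ℝ, E) γ.1), SmoothFormAt δ γ.1 →
      SmoothFieldAt 𝓘(ℝ, E) W γ.1 →
      mvfderiv 𝓘(ℝ, E) (fun y => ε * δ y (J y (W y))) γ.1 v =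
        ε * mvfderiv 𝓘(ℝ, E) (fun y => δ y (J y (W y))) γ.1 v := fun v hδ hW =>
    mvfderiv_const_mul
      ((hδ.contMDiffAt_apply (hJ.smoothFieldAt hW)).mdifferentiableAt (by simp)) ε v
  have hneg : ∀ {δ : ∀ x : M, TangentSpace 𝓘(ℝ, E) x →L[ℝ] ℝ} (v : TangentSpace 𝓘(ℝ, E) γ.1),
      SmoothFormAt δ γ.1 →
      mvfderiv 𝓘(ℝ, E) (fun y => ε * -δ y (Z y)) γ.1 v =
        -(ε * mvfderiv 𝓘(ℝ, E) (fun y => δ y (Z y)) γ.1 v) := fun {δ} v hδ => by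
    have e : (fun y => ε * -δ y (Z y)) = fun y => (-ε) * δ y (Z y) := by
      funext y
      ring
    rw [e, mvfderiv_const_mul ((hδ.contMDiffAt_apply hZ).mdifferentiableAt (by simp)), neg_mul]
  have h₁ := verticalPart_mlieBracket_lift hD hJX hJα hJY hJβ hZ
  have h₂ := verticalPart_mlieBracket_lift hD hJX hJα hY hβ hJZ
  have h₃ := verticalPart_mlieBracket_lift hD hX hα hJY hJβ hJZ
  have h₄ := verticalPart_mlieBracket_lift hD hX hα hY hβ hZ
  simp only [hsmul _ hα hZ, hsmul _ hβ hZ, hneg _ hα, hneg _ hβ,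
    smul_apply, ContinuousLinearMap.comp_apply, smul_eq_mul, map_neg, hJ.sq] at h₁ h₂ h₃ h₄
  rw [verticalPart_nijenhuis]
  simp only [inducedStructure_lift]
  rw [h₁, h₂, h₃, h₄]
  simp only [derivEnd, ContinuousLinearMap.map_add, ContinuousLinearMap.map_sub,
    ContinuousLinearMap.map_smul, hJ.sq, smul_eq_mul, ContinuousLinearMap.map_neg]
  -- The form `εβ ∘ J` evaluated at `JZ` and multiplied by the outer `ε` gives `-ε²β(Z)`, and
  -- similarly for `α`; these are the terms where `ε² = 1` enters.
  linear_combination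
    ((mvfderiv 𝓘(ℝ, E) (fun y => β y (Z y)) γ.1 (X γ.1) +
        β γ.1 (J γ.1 (D (fun y => J y (Z y)) γ.1 (X γ.1)))) -
      (mvfderiv 𝓘(ℝ, E) (fun y => α y (Z y)) γ.1 (Y γ.1) +
        α γ.1 (J γ.1 (D (fun y => J y (Z y)) γ.1 (Y γ.1))))) * hε

lemma integrable_of_inducedStructure (hD : CovariantDerivative.ContMDiffCovariantDerivative D ∞)
    (hJ : IsAlmostComplex 𝓘(ℝ, E) J)
    (h : IsIntegrable (cotangentModel E) (inducedStructure D (diagonalStructure ε J))) :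
    IsIntegrable 𝓘(ℝ, E) J where
  toIsAlmostComplex := hJ
  nijenhuis_eq_zero X Y x hX hY := by
    have h0 := smoothFormAt_extend (0 : TangentSpace 𝓘(ℝ, E) x →L[ℝ] ℝ)
    have key := dproj_nijenhuis_lift (γ := ⟨x, 0⟩) hD hJ ε hX h0 hY h0
    rw [h.nijenhuis_eq_zero _ _ _ (smoothFieldAt_lift (γ := ⟨x, 0⟩) hD hX h0)
      (smoothFieldAt_lift (γ := ⟨x, 0⟩) hD hY h0), ContinuousLinearMap.map_zero] at key
    exact key.symm

/-- On the zero section, with the first form zero at `x`, only the term in the second form survives,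
and its value `ξ` at `x` is arbitrary. The second base field plays no role there and is taken to be
`X`. -/
lemma derivEnd_of_inducedStructure (hD : CovariantDerivative.ContMDiffCovariantDerivative D ∞)
    (hJ : IsAlmostComplex 𝓘(ℝ, E) J) (hε : ε * ε = 1)
    (h : IsIntegrable (cotangentModel E) (inducedStructure D (diagonalStructure ε J)))
    (hX : SmoothFieldAt 𝓘(ℝ, E) X x) (hZ : SmoothFieldAt 𝓘(ℝ, E) Z x) :
    ε • derivEnd D J (fun y => J y (X y)) Z x + J x (derivEnd D J X Z x) = 0 := by
  refine eq_zero_of_forall_covector fun ξ => ?_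
  have h0 := smoothFormAt_extend (0 : TangentSpace 𝓘(ℝ, E) x →L[ℝ] ℝ)
  have hξ := smoothFormAt_extend ξ
  have key := verticalPart_nijenhuis_lift (γ := ⟨x, 0⟩) hD hJ hε hX h0 hX hξ hZ
  rw [h.nijenhuis_eq_zero _ _ _ (smoothFieldAt_lift (γ := ⟨x, 0⟩) hD hX h0)
    (smoothFieldAt_lift (γ := ⟨x, 0⟩) hD hX hξ), LinearMap.map_zero, covector_extend_self,
    covector_extend_self, zero_apply, zero_apply, zero_apply, zero_add, sub_zero] at key
  exact key.symm

/-- With both forms zero at `x`, only the pairing with the base covector `ξ` remains, and `ξ` is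
arbitrary. -/
lemma curvature_of_inducedStructure (hD : CovariantDerivative.ContMDiffCovariantDerivative D ∞)
    (hJ : IsAlmostComplex 𝓘(ℝ, E) J) (hε : ε * ε = 1)
    (h : IsIntegrable (cotangentModel E) (inducedStructure D (diagonalStructure ε J)))
    (hX : SmoothFieldAt 𝓘(ℝ, E) X x) (hY : SmoothFieldAt 𝓘(ℝ, E) Y x)
    (hZ : SmoothFieldAt 𝓘(ℝ, E) Z x) :
    (curvature D X Y Z x - curvature D (fun y => J y (X y)) (fun y => J y (Y y)) Z x)
      + ε • (curvature D (fun y => J y (X y)) Y (fun y => J y (Z y)) x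
        + curvature D X (fun y => J y (Y y)) (fun y => J y (Z y)) x) = 0 := by
  refine eq_zero_of_forall_covector fun ξ => ?_
  have h0 := smoothFormAt_extend (0 : TangentSpace 𝓘(ℝ, E) x →L[ℝ] ℝ)
  have key := verticalPart_nijenhuis_lift (γ := ⟨x, ξ⟩) hD hJ hε hX h0 hY h0 hZ
  rw [h.nijenhuis_eq_zero _ _ _ (smoothFieldAt_lift (γ := ⟨x, ξ⟩) hD hX h0)
    (smoothFieldAt_lift (γ := ⟨x, ξ⟩) hD hY h0), LinearMap.map_zero, covector_extend_self,
    zero_apply, zero_apply, zero_apply, add_zero, sub_zero] at key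
  exact key.symm

/-- Any two fields may be replaced by lifts with the same values at `γ`, and the lifted vector
fields can be chosen globally smooth. The conditions are thus needed for global fields only, which
form a Lie ring. -/
lemma isIntegrable_inducedStructure (hD : CovariantDerivative.ContMDiffCovariantDerivative D ∞)
    (hJ : IsIntegrable 𝓘(ℝ, E) J) (hε : ε * ε = 1)
    (hdJ : ∀ X Z : ∀ x : M, TangentSpace 𝓘(ℝ, E) x, (∀ y, SmoothFieldAt 𝓘(ℝ, E) X y) →
      (∀ y, SmoothFieldAt 𝓘(ℝ, E) Z y) → ∀ x,
      ε • derivEnd D J (fun y => J y (X y)) Z x + J x (derivEnd D J X Z x) = 0)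
    (hR : ∀ X Y Z : ∀ x : M, TangentSpace 𝓘(ℝ, E) x, (∀ y, SmoothFieldAt 𝓘(ℝ, E) X y) →
      (∀ y, SmoothFieldAt 𝓘(ℝ, E) Y y) → (∀ y, SmoothFieldAt 𝓘(ℝ, E) Z y) → ∀ x,
      (curvature D X Y Z x - curvature D (fun y => J y (X y)) (fun y => J y (Y y)) Z x)
        + ε • (curvature D (fun y => J y (X y)) Y (fun y => J y (Z y)) x
          + curvature D X (fun y => J y (Y y)) (fun y => J y (Z y)) x) = 0) :
    IsIntegrable (cotangentModel E) (inducedStructure D (diagonalStructure ε J)) where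
  toIsAlmostComplex := isAlmostComplex_inducedStructure hD hJ.toIsAlmostComplex hε
  nijenhuis_eq_zero V W γ hV hW := by
    have hJ' := hJ.toIsAlmostComplex
    obtain ⟨X, hX, hXv⟩ := exists_smoothField (dproj γ (V γ))
    obtain ⟨Y, hY, hYw⟩ := exists_smoothField (dproj γ (W γ))
    have hα := smoothFormAt_extend (verticalPart D γ (V γ))
    have hβ := smoothFormAt_extend (verticalPart D γ (W γ))
    have eV := covector_extend_self (verticalPart D γ (V γ))
    have eW := covector_extend_self (verticalPart D γ (W γ))
    set α := FiberBundle.extend (E := fun x : M => TangentSpace 𝓘(ℝ, E) x →L[ℝ] ℝ)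
      (E →L[ℝ] ℝ) (verticalPart D γ (V γ))
    set β := FiberBundle.extend (E := fun x : M => TangentSpace 𝓘(ℝ, E) x →L[ℝ] ℝ)
      (E →L[ℝ] ℝ) (verticalPart D γ (W γ))
    have hVl : V γ = lift D X α γ := cotangent_ext (D := D)
      (by rw [dproj_lift, hXv]) (by rw [verticalPart_lift, eV])
    have hWl : W γ = lift D Y β γ := cotangent_ext (D := D)
      (by rw [dproj_lift, hYw]) (by rw [verticalPart_lift, eW])
    have key : nijenhuis (cotangentModel E) (inducedStructure D (diagonalStructure ε J))
        (lift D X α) (lift D Y β) γ = 0 := by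
      refine cotangent_ext (D := D) ?_ ?_
      · rw [dproj_nijenhuis_lift hD hJ' ε (hX _) hα (hY _) hβ,
          hJ.nijenhuis_eq_zero _ _ _ (hX _) (hY _), ContinuousLinearMap.map_zero]
      · rw [LinearMap.map_zero]
        ext z
        obtain ⟨Z, hZ, hZz⟩ := exists_smoothField z
        rw [← hZz, verticalPart_nijenhuis_lift hD hJ' hε (hX _) hα (hY _) hβ (hZ _),
          hR X Y Z hX hY hZ, hdJ X Z hX hZ, hdJ Y Z hY hZ, ContinuousLinearMap.map_zero,
          ContinuousLinearMap.map_zero, ContinuousLinearMap.map_zero, zero_apply]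
        ring
    have : CompleteSpace (E × (E →L[ℝ] ℝ)) := FiniteDimensional.complete ℝ _
    exact (nijenhuis_congr (isAlmostComplex_inducedStructure hD hJ' hε) hV
      (smoothFieldAt_lift hD (hX _) hα) hW (smoothFieldAt_lift hD (hY _) hβ) hVl hWl).trans key

end Integrability

/-! ### Identities for a biadditive operation on a Lie ring, without multiplication by functions. -/

namespace Algebraic

variable {𝔛 : Type*} [LieRing 𝔛]

/-- The curvature of a biadditive operation on a Lie ring. -/
def curv (D : 𝔛 →+ 𝔛 →+ 𝔛) (X Y Z : 𝔛) : 𝔛 := -D X (D Y Z) + D Y (D X Z) + D ⁅X, Y⁆ Z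

/-- The derivative `(D_X J)(Y)` of an endomorphism. -/
def dEnd (D : 𝔛 →+ 𝔛 →+ 𝔛) (J : 𝔛 →+ 𝔛) (X Y : 𝔛) : 𝔛 := D X (J Y) - J (D X Y)

/-- The Nijenhuis tensor of an endomorphism of a Lie ring. -/
def nij (J : 𝔛 →+ 𝔛) (X Y : 𝔛) : 𝔛 := ⁅J X, J Y⁆ - J ⁅J X, Y⁆ - J ⁅X, J Y⁆ - ⁅X, Y⁆

variable {D : 𝔛 →+ 𝔛 →+ 𝔛} {J : 𝔛 →+ 𝔛}

/-- The derivative of `J² = -1`: `D_X J` anticommutes with `J`. -/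
lemma dEnd_apply_J (hJ : ∀ X, J (J X) = -X) (X Y : 𝔛) : dEnd D J X (J Y) = -J (dEnd D J X Y) := by
  simp only [dEnd, hJ, map_sub, map_neg]
  abel

/-- `(D_{JX}J)Z = (D_Z J)(JX) = -J(D_Z J)X = -J(D_X J)Z`. -/
lemma dEnd_J_add_of_symm (hJ : ∀ X, J (J X) = -X) (hsymm : ∀ X Y, dEnd D J X Y = dEnd D J Y X)
    (X Z : 𝔛) : dEnd D J (J X) Z + J (dEnd D J X Z) = 0 := by
  rw [hsymm, dEnd_apply_J hJ, hsymm X Z, neg_add_cancel]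

lemma nij_eq_of_torsionFree (hJ : ∀ X, J (J X) = -X) (hT : ∀ X Y, D X Y - D Y X = ⁅X, Y⁆)
    (X Y : 𝔛) : nij J X Y = (dEnd D J (J X) Y - J (dEnd D J X Y)) -
      (dEnd D J (J Y) X - J (dEnd D J Y X)) := by
  simp only [nij, dEnd, ← hT, hJ, map_sub]
  abel

lemma curv_swap (X Y Z : 𝔛) : curv D Y X Z = -curv D X Y Z := by
  simp only [curv, ← lie_skew X Y, map_neg, AddMonoidHom.neg_apply]
  abel

lemma curv_neg_right (X Y Z : 𝔛) : curv D X (-Y) Z = -curv D X Y Z := by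
  simp only [curv, lie_neg, map_neg, AddMonoidHom.neg_apply]
  abel

lemma curv_bianchi (hT : ∀ X Y, D X Y - D Y X = ⁅X, Y⁆) (X Y Z : 𝔛) :
    curv D X Y Z + curv D Y Z X + curv D Z X Y = 0 := by
  have h := lie_jacobi X Y Z
  have e1 := hT X ⁅Y, Z⁆
  have e2 := hT Y ⁅Z, X⁆
  have e3 := hT Z ⁅X, Y⁆
  rw [← e1, ← e2, ← e3] at h
  have f1 := congrArg (D X) (hT Y Z)
  have f2 := congrArg (D Y) (hT Z X)
  have f3 := congrArg (D Z) (hT X Y)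
  rw [map_sub] at f1 f2 f3
  simp only [curv]
  rw [← f1, ← f2, ← f3] at h
  rw [← neg_eq_zero, ← h]
  abel

lemma curv_apply_J (hdJ : ∀ X Y, dEnd D J X Y = 0) (X Y Z : 𝔛) :
    curv D X Y (J Z) = J (curv D X Y Z) := by
  have h : ∀ X Y, D X (J Y) = J (D X Y) := fun X Y => sub_eq_zero.1 (hdJ X Y)
  simp only [curv, h, map_add, map_neg]

/-- The `(0,2)`-part of the curvature vanishes if the `(0,1)`-part of the connection is the
Dolbeault operator. -/
lemma curv_dolbeault (hJ : ∀ X, J (J X) = -X) (hN : ∀ X Y, nij J X Y = 0)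
    (hdJ : ∀ X Y, dEnd D J X Y = 0)
    (hL : ∀ X Y, D X Y + J (D (J X) Y) = ⁅X, Y⁆ + J ⁅J X, Y⁆) (X Y Z : 𝔛) :
    (curv D X Y Z - curv D (J X) (J Y) Z) + J (curv D (J X) Y Z + curv D X (J Y) Z) = 0 := by
  have hD : ∀ X Y, D X (J Y) = J (D X Y) := fun X Y => sub_eq_zero.1 (hdJ X Y)
  -- `V = [JX, Y] + [X, JY]` is `J` applied to `U = [X, Y] - [JX, JY]`
  have hJV : J (⁅X, Y⁆ - ⁅J X, J Y⁆) = ⁅J X, Y⁆ + ⁅X, J Y⁆ := by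
    have h := congrArg J (hN X Y)
    simp only [nij, map_sub, hJ, map_zero] at h
    rw [map_sub, ← sub_eq_zero, ← neg_eq_zero, ← h]
    abel
  have hLJ : ∀ X W, J ⁅J X, J W⁆ = -⁅J X, W⁆ - ⁅X, J W⁆ + J ⁅X, W⁆ := by
    intro X W
    have h := congrArg J (hN X W)
    simp only [nij, map_sub, hJ, map_zero] at h
    rw [← sub_eq_zero, ← h]
    abel
  set L : 𝔛 → 𝔛 → 𝔛 := fun X Y => D X Y + J (D (J X) Y) with hLdef
  -- `L_X` is twice the Dolbeault operator in the direction `X`; the left-hand side is the curvature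
  -- of `L`.
  have h1 : (curv D X Y Z - curv D (J X) (J Y) Z) + J (curv D (J X) Y Z + curv D X (J Y) Z) =
      L (⁅X, Y⁆ - ⁅J X, J Y⁆) Z - (L X (L Y Z) - L Y (L X Z)) := by
    simp only [hLdef, hJV, curv, map_add, map_sub, map_neg, hD, hJ, AddMonoidHom.add_apply,
      AddMonoidHom.sub_apply]
    abel
  -- By `hL` the operator `L` is made of brackets and `J` alone, and `N_J = 0` moves every `J` out
  -- of the inner brackets. The Jacobi identity then finishes the proof.
  have h2 : ∀ X Y Z, L X (L Y Z) =
      ⁅X, ⁅Y, Z⁆⁆ + J ⁅J X, ⁅Y, Z⁆⁆ + J ⁅X, ⁅J Y, Z⁆⁆ - ⁅J X, ⁅J Y, Z⁆⁆ := by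
    intro X Y Z
    simp only [hLdef, hL, lie_add, map_add, hLJ]
    abel
  have h3 : L (⁅X, Y⁆ - ⁅J X, J Y⁆) Z =
      ⁅⁅X, Y⁆, Z⁆ - ⁅⁅J X, J Y⁆, Z⁆ + J (⁅⁅J X, Y⁆, Z⁆ + ⁅⁅X, J Y⁆, Z⁆) := by
    simp only [hLdef]
    rw [hL, hJV, sub_lie, add_lie]
  rw [h1, h2, h2, h3]
  simp only [lie_lie, map_add, map_sub]
  abel

/-! ### Identities for a jointly nondegenerate family of pairings, later the metric at each point.
-/

section Metric

variable {ι : Type*} {g : ι → 𝔛 →+ 𝔛 →+ ℝ}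

/-- Put `A(X,Y,Z) = g((D_{JX}J)Y - J(D_X J)Y, Z)`. Vanishing of `N_J` makes `A` symmetric in `X, Y`,
and compatibility with the metric makes it skew in `Y, Z`; a trilinear expression with both
symmetries is zero. -/
lemma dEnd_J_of_nij (hJ : ∀ X, J (J X) = -X) (hT : ∀ X Y, D X Y - D Y X = ⁅X, Y⁆)
    (hg : ∀ V, (∀ i W, g i V W = 0) → V = 0) (hgJ : ∀ i X Y, g i (J X) Y = -g i X (J Y))
    (hB : ∀ i X Y Z, g i (dEnd D J X Y) Z = -g i (dEnd D J X Z) Y)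
    (hN : ∀ X Y, nij J X Y = 0) (X Y : 𝔛) : dEnd D J (J X) Y = J (dEnd D J X Y) := by
  have hs : ∀ X Y, dEnd D J (J X) Y - J (dEnd D J X Y) =
      dEnd D J (J Y) X - J (dEnd D J Y X) := fun X Y =>
    sub_eq_zero.1 ((nij_eq_of_torsionFree hJ hT X Y).symm.trans (hN X Y))
  rw [← sub_eq_zero]
  refine hg _ fun i Z => ?_
  have hk : ∀ X Y Z, g i (dEnd D J (J X) Y - J (dEnd D J X Y)) Z =
      -g i (dEnd D J (J X) Z - J (dEnd D J X Z)) Y := by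
    intro X Y Z
    have h := hB i X Y (J Z)
    rw [dEnd_apply_J hJ, map_neg, AddMonoidHom.neg_apply] at h
    rw [map_sub, map_sub, AddMonoidHom.sub_apply, AddMonoidHom.sub_apply, hB, hgJ]
    linarith
  have a1 := hk X Y Z
  have a2 := hk Z X Y
  have a3 := hk Y Z X
  rw [hs X Z] at a1
  rw [hs Z Y] at a2
  rw [hs Y X] at a3
  linarith

lemma dEnd_eq_zero_of_closed (hJ : ∀ X, J (J X) = -X)
    (hg : ∀ V, (∀ i W, g i V W = 0) → V = 0) (hgJ : ∀ i X Y, g i (J X) Y = -g i X (J Y))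
    (hB : ∀ i X Y Z, g i (dEnd D J X Y) Z = -g i (dEnd D J X Z) Y)
    (hA : ∀ X Y, dEnd D J (J X) Y = J (dEnd D J X Y))
    (hω : ∀ i X Y Z, g i (dEnd D J X Y) Z - g i (dEnd D J Y X) Z + g i (dEnd D J Z X) Y = 0)
    (X Y : 𝔛) : dEnd D J X Y = 0 := by
  refine hg _ fun i Z => ?_
  have h1 : ∀ X Y Z, g i (dEnd D J (J X) Y) Z = -g i (dEnd D J X Y) (J Z) := fun X Y Z => by
    rw [hA, hgJ]
  have h2 : ∀ X Y Z, g i (dEnd D J X (J Y)) Z = g i (dEnd D J X Y) (J Z) := fun X Y Z => by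
    rw [dEnd_apply_J hJ, map_neg, AddMonoidHom.neg_apply, hgJ, neg_neg]
  -- After all `J` are moved to the last entry, the sum of `c2` and `c3` is twice the quantity
  -- wanted.
  have key : ∀ Z, g i (dEnd D J X Y) (J Z) = 0 := fun Z => by
    have c1 := hω i (J X) Y Z
    have c2 := hω i X (J Y) Z
    have c3 := hω i X Y (J Z)
    simp only [h1, h2] at c1 c2 c3
    have d1 := hB i Y X (J Z)
    have d2 := hB i Y (J X) Z
    have d3 := hB i Z X (J Y)
    simp only [h2] at d1 d2 d3
    linarith
  have h := key (J Z)
  rwa [hJ, map_neg, neg_eq_zero] at h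

/-- The classical argument: four cyclic instances of the first Bianchi identity, combined with
skewness in each pair of entries. -/
lemma curv_pair_symm (hT : ∀ X Y, D X Y - D Y X = ⁅X, Y⁆)
    (hR : ∀ i X Y Z W, g i (curv D X Y Z) W = -g i (curv D X Y W) Z) (i : ι) (X Y Z W : 𝔛) :
    g i (curv D X Y Z) W = g i (curv D Z W X) Y := by
  have hs : ∀ X Y Z W, g i (curv D Y X Z) W = -g i (curv D X Y Z) W := fun X Y Z W => by
    rw [curv_swap, map_neg, AddMonoidHom.neg_apply]
  have hb : ∀ X Y Z W,
      g i (curv D X Y Z) W + g i (curv D Y Z X) W + g i (curv D Z X Y) W = 0 := fun X Y Z W => by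
    rw [← AddMonoidHom.add_apply, ← AddMonoidHom.add_apply, ← map_add, ← map_add,
      curv_bianchi hT, map_zero, AddMonoidHom.zero_apply]
  have b1 := hb X Y Z W
  have b2 := hb Y Z W X
  have b3 := hb Z W X Y
  have b4 := hb W X Y Z
  have r1 := hR i Y Z W X
  have r2 := hR i Z W Y X
  have r3 := hR i W Y Z X
  have r4 := hR i W X Y Z
  have r5 := hR i X Y W Z
  have r6 := hR i Z X W Y
  have r7 := hR i W X Z Y
  have s1 := hs X Z W Y
  have s2 := hs W Y Z X
  have s3 := hs W Y X Z
  linarith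

/-- The curvature of a Kähler manifold is of type `(1,1)`. -/
lemma curv_J_J (hT : ∀ X Y, D X Y - D Y X = ⁅X, Y⁆)
    (hg : ∀ V, (∀ i W, g i V W = 0) → V = 0) (hgJ : ∀ i X Y, g i (J X) (J Y) = g i X Y)
    (hR : ∀ i X Y Z W, g i (curv D X Y Z) W = -g i (curv D X Y W) Z)
    (hdJ : ∀ X Y, dEnd D J X Y = 0) (X Y Z : 𝔛) :
    curv D (J X) (J Y) Z = curv D X Y Z := by
  rw [← sub_eq_zero]
  refine hg _ fun i W => ?_
  rw [map_sub, AddMonoidHom.sub_apply, curv_pair_symm hT hR, curv_apply_J hdJ, hgJ,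
    curv_pair_symm hT hR i X Y, sub_self]

/-- Type `(1,1)` kills both brackets separately: `R(JX,JY) = R(X,Y)`, and with `JY` in place of `Y`,
`R(X,JY) = -R(JX,Y)`. -/
lemma curv_kaehler (hJ : ∀ X, J (J X) = -X) (hT : ∀ X Y, D X Y - D Y X = ⁅X, Y⁆)
    (hg : ∀ V, (∀ i W, g i V W = 0) → V = 0) (hgJ : ∀ i X Y, g i (J X) (J Y) = g i X Y)
    (hR : ∀ i X Y Z W, g i (curv D X Y Z) W = -g i (curv D X Y W) Z)
    (hdJ : ∀ X Y, dEnd D J X Y = 0) (X Y Z : 𝔛) :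
    (curv D X Y Z - curv D (J X) (J Y) Z) + (curv D (J X) Y (J Z) + curv D X (J Y) (J Z)) = 0 := by
  rw [curv_J_J hT hg hgJ hR hdJ, ← curv_J_J hT hg hgJ hR hdJ X (J Y), hJ, curv_neg_right, sub_self,
    zero_add, add_neg_cancel]

/-- The curvature endomorphisms and `J` are skew and commute, so passing to the adjoint in
`curv_dolbeault` changes the relative sign of the term with `J`. -/
lemma curv_dolbeault_neg (hJ : ∀ X, J (J X) = -X) (hN : ∀ X Y, nij J X Y = 0)
    (hdJ : ∀ X Y, dEnd D J X Y = 0)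
    (hL : ∀ X Y, D X Y + J (D (J X) Y) = ⁅X, Y⁆ + J ⁅J X, Y⁆)
    (hg : ∀ V, (∀ i W, g i V W = 0) → V = 0) (hgJ : ∀ i X Y, g i (J X) Y = -g i X (J Y))
    (hR : ∀ i X Y Z W, g i (curv D X Y Z) W = -g i (curv D X Y W) Z) (X Y Z : 𝔛) :
    (curv D X Y Z - curv D (J X) (J Y) Z) - J (curv D (J X) Y Z + curv D X (J Y) Z) = 0 := by
  refine hg _ fun i W => ?_
  have h := congrArg (fun V => g i V Z) (curv_dolbeault hJ hN hdJ hL X Y W)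
  have e1 := hR i (J X) Y Z (J W)
  have e2 := hR i X (J Y) Z (J W)
  simp only [map_add, map_sub, map_zero, AddMonoidHom.add_apply, AddMonoidHom.sub_apply,
    AddMonoidHom.zero_apply, hgJ, curv_apply_J hdJ] at h e1 e2 ⊢
  have e3 := hR i X Y Z W
  have e4 := hR i (J X) (J Y) Z W
  linarith

end Metric

end Algebraic

/-! ### The Lie ring of global smooth vector fields. -/

section SmoothFields

variable {E : Type*} [NormedAddCommGroup E] [NormedSpace ℝ E]
  {M : Type*} [TopologicalSpace M] [ChartedSpace E M] [IsManifold 𝓘(ℝ, E) ∞ M]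

variable (E M) in
/-- The group of smooth vector fields on `M`. -/
noncomputable def smoothFields : AddSubgroup (∀ x : M, TangentSpace 𝓘(ℝ, E) x) where
  carrier := {X | ∀ x, SmoothFieldAt 𝓘(ℝ, E) X x}
  add_mem' hX hY x := (hX x).add (hY x)
  zero_mem' x := SmoothFieldAt.zero x
  neg_mem' hX x := (hX x).neg

variable {J : ∀ x : M, TangentSpace 𝓘(ℝ, E) x →L[ℝ] TangentSpace 𝓘(ℝ, E) x}

/-- The action of an almost complex structure on smooth vector fields. -/
noncomputable def fieldEnd (hJ : IsAlmostComplex 𝓘(ℝ, E) J) : smoothFields E M →+ smoothFields E M where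
  toFun X := ⟨fun x => J x (X.1 x), fun x => hJ.smoothFieldAt (X.2 x)⟩
  map_zero' := Subtype.ext (funext fun x => ContinuousLinearMap.map_zero (J x))
  map_add' X Y := Subtype.ext (funext fun x => ContinuousLinearMap.map_add (J x) (X.1 x) (Y.1 x))

lemma fieldEnd_fieldEnd (hJ : IsAlmostComplex 𝓘(ℝ, E) J) (X : smoothFields E M) :
    fieldEnd hJ (fieldEnd hJ X) = -X :=
  Subtype.ext (funext fun x => hJ.sq x (X.1 x))

/-- A metric, as a family of pairings of smooth vector fields. -/
noncomputable def fieldMetric (g : SmoothMetric E M) (x : M) : smoothFields E M →+ smoothFields E M →+ ℝ :=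
  AddMonoidHom.mk' (fun X => AddMonoidHom.mk' (fun Y => g.inner x (X.1 x) (Y.1 x))
    fun Y Z => ContinuousLinearMap.map_add (g.inner x (X.1 x)) (Y.1 x) (Z.1 x))
    fun X Y => AddMonoidHom.ext fun Z => congrArg (fun A => A (Z.1 x))
      (ContinuousLinearMap.map_add (g.inner x) (X.1 x) (Y.1 x))

lemma fieldMetric_nondegenerate (g : SmoothMetric E M) (V : smoothFields E M)
    (h : ∀ x W, fieldMetric g x V W = 0) : V = 0 := by
  refine Subtype.ext (funext fun x => ?_)
  by_contra hv
  exact (g.pos x (V.1 x) hv).ne' (h x V)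

lemma IsAlmostHermitian.fieldMetric_J_J {g : SmoothMetric E M} (h : IsAlmostHermitian g J) (x : M)
    (X Y : smoothFields E M) :
    fieldMetric g x (fieldEnd h.almostComplex X) (fieldEnd h.almostComplex Y) =
      fieldMetric g x X Y :=
  h.compatible x (X.1 x) (Y.1 x)

lemma IsAlmostHermitian.inner_J {g : SmoothMetric E M} (h : IsAlmostHermitian g J) (x : M)
    (u v : TangentSpace 𝓘(ℝ, E) x) : g.inner x (J x u) v = -g.inner x u (J x v) := by
  have h1 := h.compatible x u (J x v)
  rw [h.almostComplex.sq, ContinuousLinearMap.map_neg] at h1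
  linarith

lemma IsAlmostHermitian.fieldMetric_J {g : SmoothMetric E M} (h : IsAlmostHermitian g J) (x : M)
    (X Y : smoothFields E M) :
    fieldMetric g x (fieldEnd h.almostComplex X) Y =
      -fieldMetric g x X (fieldEnd h.almostComplex Y) :=
  h.inner_J x (X.1 x) (Y.1 x)

variable [FiniteDimensional ℝ E]

noncomputable instance : LieRing (smoothFields E M) where
  bracket X Y := ⟨mlieBracket 𝓘(ℝ, E) X.1 Y.1, fun x =>
    have : CompleteSpace E := FiniteDimensional.complete ℝ E
    (X.2 x).mlieBracket (Y.2 x)⟩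
  add_lie X Y Z := Subtype.ext (funext fun x =>
    mlieBracket_add_left (X.2 x).mdifferentiableAt (Y.2 x).mdifferentiableAt)
  lie_add X Y Z := Subtype.ext (funext fun x =>
    mlieBracket_add_right (Y.2 x).mdifferentiableAt (Z.2 x).mdifferentiableAt)
  lie_self X := Subtype.ext mlieBracket_self
  leibniz_lie X Y Z := Subtype.ext (funext fun x => by
    have : CompleteSpace E := FiniteDimensional.complete ℝ E
    have : IsManifold 𝓘(ℝ, E) (minSmoothness ℝ 3) M := by
      rw [minSmoothness_of_isRCLikeNormedField]
      exact IsManifold.of_le (n := ∞) ENat.LEInfty.out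
    have h : ∀ X : smoothFields E M, ContMDiffAt 𝓘(ℝ, E) 𝓘(ℝ, E).tangent (minSmoothness ℝ 2)
        (fun y => (⟨y, X.1 y⟩ : TangentBundle 𝓘(ℝ, E) M)) x := fun X => by
      rw [minSmoothness_of_isRCLikeNormedField]
      exact ContMDiffAt.of_le (X.2 x) ENat.LEInfty.out
    exact leibniz_identity_mlieBracket_apply (h X) (h Y) (h Z))

lemma nij_fieldEnd_eq_zero (hJ : IsIntegrable 𝓘(ℝ, E) J) (X Y : smoothFields E M) :
    Algebraic.nij (fieldEnd hJ.toIsAlmostComplex) X Y = 0 :=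
  Subtype.ext (funext fun x => hJ.nijenhuis_eq_zero X.1 Y.1 x (X.2 x) (Y.2 x))

lemma IsTorsionFree.apply {D : Connection E M} (hT : IsTorsionFree D)
    {X Y : ∀ x : M, TangentSpace 𝓘(ℝ, E) x} {x : M} (hX : SmoothFieldAt 𝓘(ℝ, E) X x) (hY : SmoothFieldAt 𝓘(ℝ, E) Y x) :
    D Y x (X x) - D X x (Y x) = mlieBracket 𝓘(ℝ, E) X Y x :=
  have : CompleteSpace E := FiniteDimensional.complete ℝ E
  (CovariantDerivative.torsion_eq_zero_iff D).1 hT hX.mdifferentiableAt hY.mdifferentiableAt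

variable [T2Space M] {D : Connection E M}

/-- A smooth connection, as an operation on smooth vector fields. -/
noncomputable def fieldConnection (D : Connection E M)
    (hD : CovariantDerivative.ContMDiffCovariantDerivative D ∞) :
    smoothFields E M →+ smoothFields E M →+ smoothFields E M :=
  AddMonoidHom.mk' (fun X => AddMonoidHom.mk'
    (fun Z => ⟨fun x => D Z.1 x (X.1 x), fun x => (X.2 x).connection hD (Z.2 x)⟩)
    fun Z W => Subtype.ext (funext fun x => congrArg (fun A => A (X.1 x))
      (D.isCovariantDerivativeOn.add (Z.2 x).mdifferentiableAt (W.2 x).mdifferentiableAt)))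
    fun X Y => AddMonoidHom.ext fun Z => Subtype.ext (funext fun x =>
      ContinuousLinearMap.map_add (D Z.1 x) (X.1 x) (Y.1 x))

lemma curv_fieldConnection (hD : CovariantDerivative.ContMDiffCovariantDerivative D ∞)
    (X Y Z : smoothFields E M) (x : M) :
    (Algebraic.curv (fieldConnection D hD) X Y Z).1 x = curvature D X.1 Y.1 Z.1 x := rfl

lemma IsTorsionFree.fieldConnection (hT : IsTorsionFree D)
    (hD : CovariantDerivative.ContMDiffCovariantDerivative D ∞) (X Y : smoothFields E M) :
    fieldConnection D hD X Y - fieldConnection D hD Y X = ⁅X, Y⁆ :=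
  Subtype.ext (funext fun x => hT.apply (X.2 x) (Y.2 x))

end SmoothFields

/-! ### Metric connections: skewness of `DJ` and of the curvature, and the differential of `ω`. -/

section Metric

variable {E : Type*} [NormedAddCommGroup E] [NormedSpace ℝ E]
  {M : Type*} [TopologicalSpace M] [ChartedSpace E M] [IsManifold 𝓘(ℝ, E) ∞ M]
  {J : ∀ x : M, TangentSpace 𝓘(ℝ, E) x →L[ℝ] TangentSpace 𝓘(ℝ, E) x}
  {D : Connection E M} {g : SmoothMetric E M}
  {X Y Z : ∀ x : M, TangentSpace 𝓘(ℝ, E) x} {x : M}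

lemma contMDiffAt_metric (g : SmoothMetric E M) (hY : SmoothFieldAt 𝓘(ℝ, E) Y x)
    (hZ : SmoothFieldAt 𝓘(ℝ, E) Z x) :
    ContMDiffAt 𝓘(ℝ, E) 𝓘(ℝ, ℝ) ∞ (fun y => g.inner y (Y y) (Z y)) x := by
  have h : ContMDiffAt 𝓘(ℝ, E) (𝓘(ℝ, E).prod 𝓘(ℝ, ℝ)) ∞
      (fun y : M => TotalSpace.mk' ℝ (E := Bundle.Trivial M ℝ) y (g.inner y (Y y) (Z y))) x :=
    ContMDiffAt.clm_bundle_apply₂ (F₁ := E) (F₂ := E) (F₃ := ℝ)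
      (E₁ := fun x : M => TangentSpace 𝓘(ℝ, E) x) (E₂ := fun x : M => TangentSpace 𝓘(ℝ, E) x)
      (E₃ := Bundle.Trivial M ℝ) (b := fun y => y) (g.contMDiff x) hY hZ
  exact (contMDiffAt_totalSpace.1 h).2

lemma tensorialAt_derivEnd (hJ : IsAlmostComplex 𝓘(ℝ, E) J) (D : Connection E M)
    (X : ∀ x : M, TangentSpace 𝓘(ℝ, E) x) (x : M) :
    TensorialAt 𝓘(ℝ, E) E (fun Y => derivEnd D J X Y x) x where
  smul {f Y} hf hY := by
    have hJY := hJ.mdifferentiableAt hY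
    have e : (fun y => J y ((f • Y) y)) = f • fun y => J y (Y y) := by
      funext y
      exact ContinuousLinearMap.map_smul (J y) (f y) (Y y)
    simp only [derivEnd, e, D.isCovariantDerivativeOn.leibniz hY hf,
      D.isCovariantDerivativeOn.leibniz hJY hf]
    simp
    module
  add {Y Y'} hY hY' := by
    have e : (fun y => J y ((Y + Y') y)) = (fun y => J y (Y y)) + fun y => J y (Y' y) := by
      funext y
      exact ContinuousLinearMap.map_add (J y) (Y y) (Y' y)
    simp only [derivEnd, e, D.isCovariantDerivativeOn.add hY hY',
      D.isCovariantDerivativeOn.add (hJ.mdifferentiableAt hY) (hJ.mdifferentiableAt hY'),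
      add_apply, ContinuousLinearMap.map_add]
    abel

/-- Differentiate `g(JY, Z) = -g(Y, JZ)` along `X` with `Dg = 0`. -/
lemma derivEnd_skew (hg : IsAlmostHermitian g J) (hm : IsMetric g D)
    (hX : SmoothFieldAt 𝓘(ℝ, E) X x) (hY : SmoothFieldAt 𝓘(ℝ, E) Y x)
    (hZ : SmoothFieldAt 𝓘(ℝ, E) Z x) :
    g.inner x (derivEnd D J X Y x) (Z x) = -g.inner x (derivEnd D J X Z x) (Y x) := by
  have hJY := hg.almostComplex.smoothFieldAt hY
  have hJZ := hg.almostComplex.smoothFieldAt hZ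
  have h1 := hm X _ Z x hX hJY hZ
  have h2 := hm X Y _ x hX hY hJZ
  have e : (fun y => g.inner y (J y (Y y)) (Z y)) =
      fun y => (-1) * g.inner y (Y y) (J y (Z y)) := by
    funext y
    rw [hg.inner_J]
    ring
  rw [e, mvfderiv_const_mul ((contMDiffAt_metric g hY hJZ).mdifferentiableAt (by simp)), h2] at h1
  simp only [derivEnd, ContinuousLinearMap.map_sub, sub_apply, hg.inner_J] at h1 ⊢
  rw [g.symm x (D (fun y => J y (Z y)) x (X x)), g.symm x (D Z x (X x)), hg.inner_J]
  linarith

variable [FiniteDimensional ℝ E]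

lemma dFundamentalForm_eq (hg : IsAlmostHermitian g J) (hm : IsMetric g D) (hT : IsTorsionFree D)
    (hX : SmoothFieldAt 𝓘(ℝ, E) X x) (hY : SmoothFieldAt 𝓘(ℝ, E) Y x)
    (hZ : SmoothFieldAt 𝓘(ℝ, E) Z x) :
    dFundamentalForm g J X Y Z x = g.inner x (derivEnd D J X Y x) (Z x)
      - g.inner x (derivEnd D J Y X x) (Z x) + g.inner x (derivEnd D J Z X x) (Y x) := by
  have hJX := hg.almostComplex.smoothFieldAt hX
  have hJY := hg.almostComplex.smoothFieldAt hY
  have h1 : mvfderiv 𝓘(ℝ, E) (fundamentalForm g J Y Z) x (X x) = _ := hm X _ Z x hX hJY hZ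
  have h2 : mvfderiv 𝓘(ℝ, E) (fundamentalForm g J X Z) x (Y x) = _ := hm Y _ Z x hY hJX hZ
  have h3 : mvfderiv 𝓘(ℝ, E) (fundamentalForm g J X Y) x (Z x) = _ := hm Z _ Y x hZ hJX hY
  rw [dFundamentalForm, h1, h2, h3]
  simp only [fundamentalForm]
  rw [← hT.apply hX hY, ← hT.apply hX hZ, ← hT.apply hY hZ]
  simp only [derivEnd, ContinuousLinearMap.map_sub, sub_apply, hg.inner_J]
  rw [g.symm x (D Z x (X x)), g.symm x (D Z x (Y x)), g.symm x (D Y x (Z x)), hg.inner_J,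
    hg.inner_J, hg.inner_J]
  ring

variable [T2Space M]

/-- Apply `[X, Y]` as a commutator of derivations to the function `g(Z, W)`: the mixed terms `g(D_X
Z, D_Y W)` cancel. -/
lemma curvature_skew (hD : CovariantDerivative.ContMDiffCovariantDerivative D ∞)
    (hm : IsMetric g D) (X Y Z W : smoothFields E M) (x : M) :
    g.inner x (curvature D X.1 Y.1 Z.1 x) (W.1 x) =
      -g.inner x (curvature D X.1 Y.1 W.1 x) (Z.1 x) := by
  have : CompleteSpace E := FiniteDimensional.complete ℝ E
  have hd : ∀ X Y : smoothFields E M,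
      MDifferentiableAt 𝓘(ℝ, E) 𝓘(ℝ, ℝ) (fun y => g.inner y (X.1 y) (Y.1 y)) x := fun X Y =>
    (contMDiffAt_metric g (X.2 x) (Y.2 x)).mdifferentiableAt (by simp)
  have h2 : ∀ X Y : smoothFields E M,
      mvfderiv 𝓘(ℝ, E) (fun y => mvfderiv 𝓘(ℝ, E) (fun y => g.inner y (Z.1 y) (W.1 y)) y (Y.1 y))
        x (X.1 x) =
      g.inner x ((fieldConnection D hD X (fieldConnection D hD Y Z)).1 x) (W.1 x)
        + g.inner x ((fieldConnection D hD Y Z).1 x) ((fieldConnection D hD X W).1 x)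
        + (g.inner x ((fieldConnection D hD X Z).1 x) ((fieldConnection D hD Y W).1 x)
        + g.inner x (Z.1 x) ((fieldConnection D hD X (fieldConnection D hD Y W)).1 x)) := by
    intro X Y
    have e : (fun y => mvfderiv 𝓘(ℝ, E) (fun y => g.inner y (Z.1 y) (W.1 y)) y (Y.1 y)) =
        (fun y => g.inner y ((fieldConnection D hD Y Z).1 y) (W.1 y)) +
          fun y => g.inner y (Z.1 y) ((fieldConnection D hD Y W).1 y) := by
      funext y
      exact hm Y.1 Z.1 W.1 y (Y.2 y) (Z.2 y) (W.2 y)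
    rw [e, mvfderiv_add (hd _ _) (hd _ _), add_apply,
      hm _ _ _ x (X.2 x) ((fieldConnection D hD Y Z).2 x) (W.2 x),
      hm _ _ _ x (X.2 x) (Z.2 x) ((fieldConnection D hD Y W).2 x)]
    rfl
  have h1 := mvfderiv_mlieBracket
    ((contMDiffAt_metric g (Z.2 x) (W.2 x)).of_le (m := 2) ENat.LEInfty.out)
    (X.2 x).mdifferentiableAt (Y.2 x).mdifferentiableAt
  have h3 := hm _ _ _ x (⁅X, Y⁆.2 x) (Z.2 x) (W.2 x)
  have h4 := (h3.symm.trans h1).trans (congrArg₂ (· - ·) (h2 X Y) (h2 Y X))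
  rw [← curv_fieldConnection hD, ← curv_fieldConnection hD]
  have e : ∀ Z W : smoothFields E M, g.inner x ((Algebraic.curv (fieldConnection D hD) X Y Z).1 x)
      (W.1 x) = -g.inner x ((fieldConnection D hD X (fieldConnection D hD Y Z)).1 x) (W.1 x)
        + g.inner x ((fieldConnection D hD Y (fieldConnection D hD X Z)).1 x) (W.1 x)
        + g.inner x (D Z.1 x (⁅X, Y⁆.1 x)) (W.1 x) := fun Z W => by
    change fieldMetric g x (Algebraic.curv (fieldConnection D hD) X Y Z) W =
      -fieldMetric g x (fieldConnection D hD X (fieldConnection D hD Y Z)) W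
        + fieldMetric g x (fieldConnection D hD Y (fieldConnection D hD X Z)) W
        + fieldMetric g x (fieldConnection D hD ⁅X, Y⁆ Z) W
    simp only [Algebraic.curv, map_add, map_neg, AddMonoidHom.add_apply, AddMonoidHom.neg_apply]
  rw [e Z W, e W Z, g.symm x _ (Z.1 x), g.symm x _ (Z.1 x), g.symm x _ (Z.1 x)]
  linarith

/-- The Lie ring gives identities for global fields only; tensoriality carries them over to fields
smooth near a point, as the Kähler condition requires. -/
lemma derivEnd_eq_zero_of_global (hJ : IsAlmostComplex 𝓘(ℝ, E) J)
    (h : ∀ X Y : smoothFields E M, ∀ x, derivEnd D J X.1 Y.1 x = 0)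
    (hY : SmoothFieldAt 𝓘(ℝ, E) Y x) : derivEnd D J X Y x = 0 := by
  obtain ⟨X', hX', hXx⟩ := exists_smoothField (X x)
  obtain ⟨Y', hY', hYx⟩ := exists_smoothField (Y x)
  rw [(tensorialAt_derivEnd hJ D X x).pointwise hY.mdifferentiableAt (hY' x).mdifferentiableAt
    hYx.symm, ← h ⟨X', hX'⟩ ⟨Y', hY'⟩ x]
  simp only [derivEnd, hXx]

end Metric

/-! ### The special complex, Levi-Civita and Chern cases. -/

section Main

variable {E : Type*} [NormedAddCommGroup E] [NormedSpace ℝ E] [FiniteDimensional ℝ E]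
  {M : Type*} [TopologicalSpace M] [T2Space M] [ChartedSpace E M] [IsManifold 𝓘(ℝ, E) ∞ M]
  {J : ∀ x : M, TangentSpace 𝓘(ℝ, E) x →L[ℝ] TangentSpace 𝓘(ℝ, E) x}
  {D : Connection E M} {g : SmoothMetric E M}
  {X Y Z : ∀ x : M, TangentSpace 𝓘(ℝ, E) x} {x : M} {ε : ℝ}

/-- Integrability of `J^ε` from identities between operations on smooth vector fields. -/
lemma isIntegrable_of_fields (hD : CovariantDerivative.ContMDiffCovariantDerivative D ∞)
    (hJ : IsIntegrable 𝓘(ℝ, E) J) (hε : ε * ε = 1)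
    (hdJ : ∀ (X Z : smoothFields E M) (x : M),
      ε • (Algebraic.dEnd (fieldConnection D hD) (fieldEnd hJ.toIsAlmostComplex)
        (fieldEnd hJ.toIsAlmostComplex X) Z).1 x
        + (fieldEnd hJ.toIsAlmostComplex (Algebraic.dEnd (fieldConnection D hD)
          (fieldEnd hJ.toIsAlmostComplex) X Z)).1 x = 0)
    (hR : ∀ (X Y Z : smoothFields E M) (x : M),
      (curvature D X.1 Y.1 Z.1 x
          - curvature D (fun y => J y (X.1 y)) (fun y => J y (Y.1 y)) Z.1 x)
        + ε • (curvature D (fun y => J y (X.1 y)) Y.1 (fun y => J y (Z.1 y)) x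
          + curvature D X.1 (fun y => J y (Y.1 y)) (fun y => J y (Z.1 y)) x) = 0) :
    IsIntegrable (cotangentModel E) (inducedStructure D (diagonalStructure ε J)) :=
  isIntegrable_inducedStructure hD hJ hε (fun X Z hX hZ x => hdJ ⟨X, hX⟩ ⟨Z, hZ⟩ x)
    fun X Y Z hX hY hZ x => hR ⟨X, hX⟩ ⟨Y, hY⟩ ⟨Z, hZ⟩ x

theorem IsSpecialComplex.isIntegrable_Jplus (h : IsSpecialComplex D J)
    (hD : CovariantDerivative.ContMDiffCovariantDerivative D ∞) :
    IsIntegrable (cotangentModel E) (Jplus D J) := by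
  have hJ := h.integrable.toIsAlmostComplex
  refine isIntegrable_of_fields hD h.integrable (one_mul 1) (fun X Z x => ?_) fun X Y Z x => ?_
  · rw [one_smul]
    have hs := Algebraic.dEnd_J_add_of_symm (D := fieldConnection D hD) (fieldEnd_fieldEnd hJ)
      (fun X Y => Subtype.ext (funext fun x =>
        sub_eq_zero.1 (h.deriv_symm X.1 Y.1 x (X.2 x) (Y.2 x)))) X Z
    exact congrFun (congrArg Subtype.val hs) x
  · have hX := X.2 x
    have hY := Y.2 x
    have hZ := Z.2 x
    rw [h.flat _ _ _ x hX hY hZ, h.flat _ _ _ x (hJ.smoothFieldAt hX) (hJ.smoothFieldAt hY) hZ,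
      h.flat _ _ _ x (hJ.smoothFieldAt hX) hY (hJ.smoothFieldAt hZ),
      h.flat _ _ _ x hX (hJ.smoothFieldAt hY) (hJ.smoothFieldAt hZ)]
    simp

lemma fieldMetric_dEnd (hD : CovariantDerivative.ContMDiffCovariantDerivative D ∞)
    (hg : IsAlmostHermitian g J) (hm : IsMetric g D) (x : M) (X Y Z : smoothFields E M) :
    fieldMetric g x (Algebraic.dEnd (fieldConnection D hD) (fieldEnd hg.almostComplex) X Y) Z =
      -fieldMetric g x
        (Algebraic.dEnd (fieldConnection D hD) (fieldEnd hg.almostComplex) X Z) Y :=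
  derivEnd_skew hg hm (X.2 x) (Y.2 x) (Z.2 x)

lemma fieldMetric_curv (hD : CovariantDerivative.ContMDiffCovariantDerivative D ∞)
    (hm : IsMetric g D) (x : M) (X Y Z W : smoothFields E M) :
    fieldMetric g x (Algebraic.curv (fieldConnection D hD) X Y Z) W =
      -fieldMetric g x (Algebraic.curv (fieldConnection D hD) X Y W) Z :=
  curvature_skew hD hm X Y Z W x

/-- For the Levi-Civita connection of a Hermitian structure, `D_{JX}J = J D_X J`. -/
lemma dEnd_J_of_isLeviCivita (hD : CovariantDerivative.ContMDiffCovariantDerivative D ∞)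
    (hg : IsAlmostHermitian g J) (hLC : IsLeviCivita g D) (hJ : IsIntegrable 𝓘(ℝ, E) J)
    (X Y : smoothFields E M) :
    Algebraic.dEnd (fieldConnection D hD) (fieldEnd hg.almostComplex)
        (fieldEnd hg.almostComplex X) Y =
      fieldEnd hg.almostComplex
        (Algebraic.dEnd (fieldConnection D hD) (fieldEnd hg.almostComplex) X Y) :=
  Algebraic.dEnd_J_of_nij (fieldEnd_fieldEnd _) (hLC.torsionFree.fieldConnection hD)
    (fieldMetric_nondegenerate g) hg.fieldMetric_J (fieldMetric_dEnd hD hg hLC.metric)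
    (nij_fieldEnd_eq_zero hJ) X Y

theorem IsKaehler.isIntegrable_Jplus (hK : IsKaehler g J)
    (hD : CovariantDerivative.ContMDiffCovariantDerivative D ∞) (hLC : IsLeviCivita g D) :
    IsIntegrable (cotangentModel E) (Jplus D J) := by
  have hg := hK.toIsAlmostHermitian
  have hT := hLC.torsionFree.fieldConnection hD
  have hdJ := Algebraic.dEnd_eq_zero_of_closed (D := fieldConnection D hD)
    (fieldEnd_fieldEnd hg.almostComplex) (fieldMetric_nondegenerate g) hg.fieldMetric_J
    (fieldMetric_dEnd hD hg hLC.metric) (dEnd_J_of_isLeviCivita hD hg hLC hK.integrable)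
    fun x X Y Z => (dFundamentalForm_eq hg hLC.metric hLC.torsionFree (X.2 x) (Y.2 x)
      (Z.2 x)).symm.trans (hK.closed X.1 Y.1 Z.1 x (X.2 x) (Y.2 x) (Z.2 x))
  refine isIntegrable_of_fields hD hK.integrable (one_mul 1) (fun X Z x => ?_) fun X Y Z x => ?_
  · rw [hdJ, hdJ, map_zero, one_smul]
    exact add_zero _
  · rw [one_smul]
    exact congrFun (congrArg Subtype.val (Algebraic.curv_kaehler
      (fieldEnd_fieldEnd hg.almostComplex) hT (fieldMetric_nondegenerate g) hg.fieldMetric_J_J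
      (fieldMetric_curv hD hLC.metric) hdJ X Y Z)) x

/-- Integrability of `J⁺` gives `D_{JX}J = -J D_X J`, while `N_J = 0` gives `D_{JX}J = J D_X J`.
Hence `DJ = 0`, and `dω` is a combination of values of `DJ`. -/
theorem isKaehler_of_isIntegrable_Jplus
    (hD : CovariantDerivative.ContMDiffCovariantDerivative D ∞) (hg : IsAlmostHermitian g J)
    (hLC : IsLeviCivita g D) (h : IsIntegrable (cotangentModel E) (Jplus D J)) :
    IsKaehler g J := by
  have hJ := integrable_of_inducedStructure hD hg.almostComplex h
  have hdJ : ∀ X Y : smoothFields E M, ∀ x, derivEnd D J X.1 Y.1 x = 0 := by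
    intro X Y x
    have h1 := derivEnd_of_inducedStructure hD hg.almostComplex (one_mul 1) h (X.2 x) (Y.2 x)
    have h2 : derivEnd D J (fun y => J y (X.1 y)) Y.1 x = J x (derivEnd D J X.1 Y.1 x) :=
      congrFun (congrArg Subtype.val (dEnd_J_of_isLeviCivita hD hg hLC hJ X Y)) x
    rw [h2, one_smul, ← two_smul ℝ, smul_eq_zero_iff_right (by norm_num)] at h1
    rw [← neg_eq_zero, ← hg.almostComplex.sq, h1, ContinuousLinearMap.map_zero]
  refine ⟨⟨hg, hJ⟩, fun X Y Z x hX hY hZ => ?_⟩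
  rw [dFundamentalForm_eq hg hLC.metric hLC.torsionFree hX hY hZ,
    derivEnd_eq_zero_of_global hg.almostComplex hdJ hY,
    derivEnd_eq_zero_of_global hg.almostComplex hdJ hX,
    derivEnd_eq_zero_of_global hg.almostComplex hdJ hX]
  simp

/-- For `ε = -1` the condition on `DJ` is exactly what `N_J = 0` already implies for a Levi-Civita
connection, so only the curvature condition is left. -/
theorem isIntegrable_Jminus_iff
    (hD : CovariantDerivative.ContMDiffCovariantDerivative D ∞) (hg : IsAlmostHermitian g J)
    (hLC : IsLeviCivita g D) :
    IsIntegrable (cotangentModel E) (Jminus D J) ↔ IsIntegrable 𝓘(ℝ, E) J ∧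
      ∀ (X Y Z : ∀ x : M, TangentSpace 𝓘(ℝ, E) x) (x : M),
        SmoothFieldAt 𝓘(ℝ, E) X x → SmoothFieldAt 𝓘(ℝ, E) Y x → SmoothFieldAt 𝓘(ℝ, E) Z x →
        (curvature D X Y Z x
            - curvature D (fun y => J y (X y)) (fun y => J y (Y y)) Z x)
          - (curvature D (fun y => J y (X y)) Y (fun y => J y (Z y)) x
            + curvature D X (fun y => J y (Y y)) (fun y => J y (Z y)) x) = 0 := by
  have hε : (-1 : ℝ) * -1 = 1 := by norm_num
  refine ⟨fun h => ⟨integrable_of_inducedStructure hD hg.almostComplex h,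
    fun X Y Z x hX hY hZ => ?_⟩, fun ⟨hJ, h⟩ => ?_⟩
  · have h1 := curvature_of_inducedStructure hD hg.almostComplex hε h hX hY hZ
    rwa [neg_smul, one_smul, ← sub_eq_add_neg] at h1
  · refine isIntegrable_of_fields hD hJ hε (fun X Z x => ?_) fun X Y Z x => ?_
    · rw [dEnd_J_of_isLeviCivita hD hg hLC hJ X Z, neg_smul, one_smul]
      exact neg_add_cancel _
    · rw [neg_smul, one_smul, ← sub_eq_add_neg]
      exact h X.1 Y.1 Z.1 x (X.2 x) (Y.2 x) (Z.2 x)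

lemma IsChern.dEnd_eq_zero (h : IsChern g J D)
    (hD : CovariantDerivative.ContMDiffCovariantDerivative D ∞) (hJ : IsAlmostComplex 𝓘(ℝ, E) J)
    (X Y : smoothFields E M) : Algebraic.dEnd (fieldConnection D hD) (fieldEnd hJ) X Y = 0 :=
  Subtype.ext (funext fun x => h.parallel X.1 Y.1 x (X.2 x) (Y.2 x))

lemma IsChern.isIntegrable_of_curv (h : IsChern g J D)
    (hD : CovariantDerivative.ContMDiffCovariantDerivative D ∞) (hJ : IsIntegrable 𝓘(ℝ, E) J)
    (hε : ε * ε = 1)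
    (hR : ∀ (X Y Z : smoothFields E M) (x : M),
      (curvature D X.1 Y.1 Z.1 x
          - curvature D (fun y => J y (X.1 y)) (fun y => J y (Y.1 y)) Z.1 x)
        + ε • (curvature D (fun y => J y (X.1 y)) Y.1 (fun y => J y (Z.1 y)) x
          + curvature D X.1 (fun y => J y (Y.1 y)) (fun y => J y (Z.1 y)) x) = 0) :
    IsIntegrable (cotangentModel E) (inducedStructure D (diagonalStructure ε J)) := by
  refine isIntegrable_of_fields hD hJ hε (fun X Z x => ?_) hR
  rw [h.dEnd_eq_zero, h.dEnd_eq_zero, map_zero]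
  exact (congrArg (· + _) (smul_zero ε)).trans (add_zero _)

theorem IsChern.isIntegrable_Jplus (h : IsChern g J D) (hg : IsHermitian g J)
    (hD : CovariantDerivative.ContMDiffCovariantDerivative D ∞) :
    IsIntegrable (cotangentModel E) (Jplus D J) := by
  refine h.isIntegrable_of_curv hD hg.integrable (one_mul 1) fun X Y Z x => ?_
  have hdJ := h.dEnd_eq_zero hD hg.almostComplex
  have h1 := Algebraic.curv_dolbeault (fieldEnd_fieldEnd hg.almostComplex)
    (nij_fieldEnd_eq_zero hg.integrable) hdJ
    (fun X Y => Subtype.ext (funext fun x => h.dolbeault X.1 Y.1 x (X.2 x) (Y.2 x))) X Y Z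
  -- Since `DJ = 0`, the outer `J` can be moved onto `Z`, where the integrability criterion has it.
  rw [map_add, ← Algebraic.curv_apply_J hdJ, ← Algebraic.curv_apply_J hdJ] at h1
  rw [one_smul]
  exact congrFun (congrArg Subtype.val h1) x

theorem IsChern.isIntegrable_Jminus (h : IsChern g J D) (hg : IsHermitian g J)
    (hD : CovariantDerivative.ContMDiffCovariantDerivative D ∞) :
    IsIntegrable (cotangentModel E) (Jminus D J) := by
  refine h.isIntegrable_of_curv hD hg.integrable (by norm_num) fun X Y Z x => ?_
  have hdJ := h.dEnd_eq_zero hD hg.almostComplex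
  have h1 := Algebraic.curv_dolbeault_neg (fieldEnd_fieldEnd hg.almostComplex)
    (nij_fieldEnd_eq_zero hg.integrable) hdJ
    (fun X Y => Subtype.ext (funext fun x => h.dolbeault X.1 Y.1 x (X.2 x) (Y.2 x)))
    (fieldMetric_nondegenerate g) hg.fieldMetric_J (fieldMetric_curv hD h.metric) X Y Z
  rw [map_add, ← Algebraic.curv_apply_J hdJ, ← Algebraic.curv_apply_J hdJ] at h1
  rw [neg_smul, one_smul, ← sub_eq_add_neg]
  exact congrFun (congrArg Subtype.val h1) x

end Main

end SpecialGeometry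

theorem corollary5p2
    {E : Type*} [NormedAddCommGroup E] [NormedSpace ℝ E] [FiniteDimensional ℝ E]
    {M : Type*} [TopologicalSpace M] [T2Space M] [ChartedSpace E M] [IsManifold 𝓘(ℝ, E) ∞ M]
    (J : ∀ x : M, TangentSpace 𝓘(ℝ, E) x →L[ℝ] TangentSpace 𝓘(ℝ, E) x)
    (hJ : IsAlmostComplex 𝓘(ℝ, E) J)
    (D : Connection E M) (hD : CovariantDerivative.ContMDiffCovariantDerivative D ∞) :
    (IsSpecialComplex D J → IsIntegrable (cotangentModel E) (Jplus D J)) ∧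
    (∀ g : SmoothMetric E M, IsAlmostHermitian g J → IsLeviCivita g D →
      (IsIntegrable (cotangentModel E) (Jplus D J) ↔ IsKaehler g J) ∧
      (IsIntegrable (cotangentModel E) (Jminus D J) ↔
        IsIntegrable 𝓘(ℝ, E) J ∧
        ∀ (X Y Z : ∀ x : M, TangentSpace 𝓘(ℝ, E) x) (x : M),
          SmoothFieldAt 𝓘(ℝ, E) X x → SmoothFieldAt 𝓘(ℝ, E) Y x → SmoothFieldAt 𝓘(ℝ, E) Z x →
          (curvature D X Y Z x
              - curvature D (fun y => J y (X y)) (fun y => J y (Y y)) Z x)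
            - (curvature D (fun y => J y (X y)) Y (fun y => J y (Z y)) x
              + curvature D X (fun y => J y (Y y)) (fun y => J y (Z y)) x) = 0)) ∧
    (∀ g : SmoothMetric E M, IsHermitian g J → IsChern g J D →
      IsIntegrable (cotangentModel E) (Jplus D J) ∧
      IsIntegrable (cotangentModel E) (Jminus D J)) := by
  refine ⟨fun h => h.isIntegrable_Jplus hD, fun g hg hLC =>
    ⟨⟨isKaehler_of_isIntegrable_Jplus hD hg hLC, fun hK => hK.isIntegrable_Jplus hD hLC⟩,
      isIntegrable_Jminus_iff hD hg hLC⟩,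
    fun g hg hC => ⟨hC.isIntegrable_Jplus hg hD, hC.isIntegrable_Jminus hg hD⟩⟩
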